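/- Let $p\ge 2$ be an integer. For an integer $K\ge 1$ put $\mathcal K=\{-K,\dots,K-1\}$, and for $y,z\in\mathbb C^{\mathcal K}$ and $\sigma\in\mathbb R$ let $$\|y\|_\sigma=\Bigl(\sum_{j\in\mathcal K}\max(1,|j|)^{2\sigma}|y_j|^2\Bigr)^{1/2},\qquad (y*z)_j=\sum_{k+l\equiv j\ (\mathrm{mod}\ 2K)}y_kz_l,\qquad f(y)=\underbrace{y*\dots*y}_{p\text{ times}} .$$ Consider the spectral semi-discretization of $u_{tt}=u_{xx}+u^p$ on $\mathbb R/2\pi\mathbb Z$, $$\ddot y=-\Omega^2y+f(y),\qquad \Omega=\mathrm{diag}(\omega_j)_{j\in\mathcal K},\quad \omega_j=|j|,\tag{1}$$ and, for $h>0$ with $hK<2$, the system with modified frequencies and modified initial velocity $$\ddot z=-\widetilde\Omega^2z+f(z),\qquad z(t_0)=y(t_0),\quad \dot z(t_0)=\mathrm{sinc}(h\widetilde\Omega)^{-1}\dot y(t_0),\tag{2}$$ where $\widetilde\Omega=\mathrm{diag}(\widetilde\omega_j)$, $0\le\widetilde\omega_j<\pi/h$, $\cos(h\widetilde\omega_j)=1-\tfrac12h^2\omega_j^2$,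 and $\mathrm{sinc}(x)=\sin(x)/x$, $\mathrm{sinc}(0)=1$. The Störmer–Verlet/leapfrog method for (1) with step-size $h$ is $$y^{n+1}-2y^n+y^{n-1}=-h^2\Omega^2y^n+h^2f(y^n),\qquad 2h\dot y^n=y^{n+1}-y^{n-1}\qquad(n\ge1),$$ with $y^0=y(t_0)$, $\dot y^0=\dot y(t_0)$ and $y^1=y^0+h\dot y^0-\tfrac12h^2\Omega^2y^0+\tfrac12h^2f(y^0)$; it approximates $(y(t_n),\dot y(t_n))$ at $t_n=t_0+nh$. Theorem. Let $s\ge0$, $M\in\mathbb R$, $T\ge0$ and $c_0<2$. There are constants $C>0$ and $h_0>0$, depending only on $M$, $s$, $p$, $T$ and $c_0$, such that the following holds for all $\alpha$ with $-1\le\alpha\le\min(1,\tfrac23s+\tfrac13)$, all $K\ge1$ and all step-sizes $0<h\le h_0$ with $hK\le c_0$: if the solution $(y,\dot y)$ of (1) and the solution $(z,\dot z)$ of (2) exist for $0\le t-t_0\le T$ and satisfy there $$\|y(t)\|_{s+1}+\|\dot y(t)\|_s\le M,\qquad \|z(t)\|_{s+1}+\|\dot z(t)\|_s\le M,$$ then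 $$\|y(t_n)-y^n\|_{s+1-3(1+\alpha)/2}+\|\dot y(t_n)-\dot y^n\|_{s-3(1+\alpha)/2}\le C\,h^{1+\alpha}\qquad\text{for all } n\ge0\text{ with } 0\le t_n-t_0=nh\le T .$$ -/

import Mathlib

noncomputable section

namespace SemiWave

/-- The index set `{-K, …, K-1}` of the Fourier modes. -/
abbrev Modes (K : ℕ) : Type := {j : ℤ // j ∈ Finset.Ico (-(K : ℤ)) (K : ℤ)}

/-- Complex vectors of Fourier coefficients, indexed by `{-K, …, K-1}`. -/
abbrev Coeff (K : ℕ) : Type := Modes K → ℂ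

/-- The discrete Sobolev norm `(∑ j, max(1,|j|)^(2σ) |y_j|²)^(1/2)`. -/
def sobNorm {K : ℕ} (σ : ℝ) (y : Coeff K) : ℝ :=
  Real.sqrt (∑ j : Modes K, (max 1 |((j : ℤ) : ℝ)|) ^ (2 * σ) * ‖y j‖ ^ 2)

/-- The discrete convolution `(y ∗ z)_j = ∑ y_k z_l` over all `k, l` with `k + l ≡ j mod 2K`. -/
def conv {K : ℕ} (y z : Coeff K) : Coeff K := fun j =>
  ∑ k : Modes K, ∑ l : Modes K,
    if (k : ℤ) + (l : ℤ) ≡ (j : ℤ) [ZMOD 2 * (K : ℤ)] then y k * z l else 0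

/-- The nonlinearity `f(y) = y ∗ ⋯ ∗ y` (`p` factors); the empty product is the neutral
element of the convolution. -/
def nonlin {K : ℕ} : ℕ → Coeff K → Coeff K
  | 0, _ => fun j => if (j : ℤ) = 0 then 1 else 0
  | p + 1, y => conv y (nonlin p y)

/-- The frequencies `ω_j = |j|`. -/
def freq {K : ℕ} (j : Modes K) : ℝ := |((j : ℤ) : ℝ)|

/-- The modified frequencies: for `h ω_j < 2`, the unique number in `[0, π / h)` with
`cos (h ω̃_j) = 1 - h² ω_j² / 2`. -/
def modFreq {K : ℕ} (h : ℝ) (j : Modes K) : ℝ :=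
  Real.arccos (1 - h ^ 2 * freq j ^ 2 / 2) / h

theorem modFreq_spec {K : ℕ} {h : ℝ} (hh : 0 < h) (j : Modes K) (hj : h * freq j < 2) :
    0 ≤ modFreq h j ∧ modFreq h j < Real.pi / h ∧
      Real.cos (h * modFreq h j) = 1 - h ^ 2 * freq j ^ 2 / 2 := by
  have h0 : 0 ≤ h * freq j := mul_nonneg hh.le (abs_nonneg _)
  have h1 : -1 < 1 - h ^ 2 * freq j ^ 2 / 2 := by nlinarith
  have h2 : 1 - h ^ 2 * freq j ^ 2 / 2 ≤ 1 := by nlinarith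
  refine ⟨div_nonneg (Real.arccos_nonneg _) hh.le, ?_, ?_⟩
  · refine div_lt_div_of_pos_right (lt_of_le_of_ne (Real.arccos_le_pi _) ?_) hh
    intro hpi
    rw [Real.arccos_eq_pi] at hpi
    linarith
  · rw [modFreq, mul_div_cancel₀ _ hh.ne', Real.cos_arccos h1.le h2]

/-- `(y, v)` solves the system `y' = v`, `v' = -W² y + f(y)` on `[t₀, t₀ + T]`, where
`W = diag(w_j)`, that is, `y'' = -W² y + f(y)` with velocity `v`. -/
def IsSolution {K : ℕ} (p : ℕ) (w : Modes K → ℝ) (t₀ T : ℝ) (y v : ℝ → Coeff K) : Prop :=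
  ∀ t ∈ Set.Icc t₀ (t₀ + T),
    HasDerivWithinAt y (v t) (Set.Icc t₀ (t₀ + T)) t ∧
    HasDerivWithinAt v (fun j => -((w j : ℂ) ^ 2 * y t j) + nonlin p (y t) j)
      (Set.Icc t₀ (t₀ + T)) t

/-- Finite energy: `‖y(t)‖_{s+1} + ‖v(t)‖_s ≤ M` on `[t₀, t₀ + T]`. -/
def FiniteEnergy {K : ℕ} (s M t₀ T : ℝ) (y v : ℝ → Coeff K) : Prop :=
  ∀ t ∈ Set.Icc t₀ (t₀ + T), sobNorm (s + 1) (y t) + sobNorm s (v t) ≤ M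

/-- The positions `y^n` of the Störmer–Verlet/leapfrog method with step-size `h`, started at
`(y0, v0)`. -/
def leapfrog {K : ℕ} (p : ℕ) (h : ℝ) (y0 v0 : Coeff K) : ℕ → Coeff K
  | 0 => y0
  | 1 => fun j => y0 j + (h : ℂ) * v0 j - (1 / 2 : ℂ) * (h : ℂ) ^ 2 * (freq j : ℂ) ^ 2 * y0 j
      + (1 / 2 : ℂ) * (h : ℂ) ^ 2 * nonlin p y0 j
  | n + 2 => fun j => 2 * leapfrog p h y0 v0 (n + 1) j - leapfrog p h y0 v0 n j
      - (h : ℂ) ^ 2 * (freq j : ℂ) ^ 2 * leapfrog p h y0 v0 (n + 1) j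
      + (h : ℂ) ^ 2 * nonlin p (leapfrog p h y0 v0 (n + 1)) j

/-- The velocities of the Störmer–Verlet/leapfrog method: the given initial velocity for `n = 0`
and `(y^{n+1} - y^{n-1}) / (2h)` for `n ≥ 1`. -/
def leapfrogVel {K : ℕ} (p : ℕ) (h : ℝ) (y0 v0 : Coeff K) : ℕ → Coeff K
  | 0 => v0
  | n + 1 => fun j =>
      (leapfrog p h y0 v0 (n + 2) j - leapfrog p h y0 v0 n j) / (2 * (h : ℂ))

end SemiWave

end

/-! ### Weights, discrete Sobolev norms and aliased convolutions. -/

noncomputable section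

namespace SemiWave

open Finset

/-! On each Fourier mode the leapfrog scheme is a three-term recurrence whose homogeneous solutions
are trigonometric with phase `h ω̃_j`. Solving it exactly (`threeTerm_solution`) gives a discrete
variation-of-constants formula (`leapfrog_eq`, `leapfrogVel_eq`) whose inhomogeneity is a
trapezoidal sum. An exact solution satisfies the analogous formula with its own propagators, up to a
quadrature defect.

First use: boundedness. The factor `sinc⁻¹` in the initial velocity of (2) makes the linear
propagation of `z` coincide with that of leapfrog. What separates the two is quadrature and an
`O(h)` mismatch of the sine kernels, uniform over the modes. Both are `O(h)` in `H^(s+1)`, without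
loss of derivatives, so a bootstrapped Gronwall argument keeps leapfrog within distance 1 of `z`
(`exists_leapfrog_bound`).

Second use: comparison with `y`. Put `β = 1 + α` and `τ = s + 1 - 3β/2`. Three sources of error
occur (`exists_leapfrog_error_le`). Dispersion: the phases differ by at most `T h² wt³` over the
whole interval, and `min 1 (h² wt³) ≤ h^β wt^(3β/2)` trades this for `3β/2` derivatives. Quadrature:
the defect is `O(h)` in `H^(s+1) × H^s` and `O(h²)` in `H^(s-1) × H^(s-2)`; interpolation gives
`O(h^β)` in the required norms. Nonlinearity: on bounded sets of `H^(s+1)` it is Lipschitz from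
`H^τ` to `H^(τ-1)` for `|τ| ≤ s + 1`, and the sine propagator restores the lost derivative, so
Gronwall closes for the positions. The velocities then follow from the position bound directly.

The Lipschitz property rests on product estimates for convolutions modulo `2K`: aliasing never
increases the modulus of a frequency, so all constants are independent of `K`. -/

/-- The weight `max 1 |j|` of the discrete Sobolev norms. -/
def wt {K : ℕ} (j : Modes K) : ℝ := max 1 |((j : ℤ) : ℝ)|

variable {K : ℕ}

theorem one_le_wt (j : Modes K) : 1 ≤ wt j := le_max_left _ _

theorem wt_pos (j : Modes K) : 0 < wt j := zero_lt_one.trans_le (one_le_wt j)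

theorem freq_nonneg (j : Modes K) : 0 ≤ freq j := abs_nonneg _

theorem freq_le_wt (j : Modes K) : freq j ≤ wt j := le_max_right _ _

theorem freq_eq_zero_or (j : Modes K) : freq j = 0 ∨ (1 ≤ freq j ∧ wt j = freq j) := by
  by_cases h : (j : ℤ) = 0
  · left; simp [freq, h]
  · right
    have : (1 : ℝ) ≤ freq j := by
      have := Int.one_le_abs h
      unfold freq
      exact_mod_cast this
    exact ⟨this, max_eq_right this⟩

theorem wt_eq_one {j : Modes K} (hj : freq j = 0) : wt j = 1 := by
  unfold freq at hj
  simp [wt, hj]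

theorem freq_le_card (j : Modes K) : freq j ≤ K := by
  have h := Finset.mem_Ico.1 j.2
  have : |(j : ℤ)| ≤ K := abs_le.2 ⟨h.1, h.2.le⟩
  unfold freq
  exact_mod_cast this

/-- The isometric embedding of the coefficients with norm `sobNorm σ` into a Euclidean space. -/
def sobEmb (σ : ℝ) : Coeff K →L[ℝ] EuclideanSpace ℂ (Modes K) :=
  LinearMap.toContinuousLinearMap
    { toFun := fun y => WithLp.toLp 2 fun j => ((wt j ^ σ : ℝ) : ℂ) * y j
      map_add' := fun y z => by ext j; simp [mul_add]
      map_smul' := fun c y => by ext j; simp; ring }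

theorem sobEmb_apply (σ : ℝ) (y : Coeff K) (j : Modes K) :
    sobEmb σ y j = ((wt j ^ σ : ℝ) : ℂ) * y j := rfl

theorem norm_sobEmb (σ : ℝ) (y : Coeff K) : ‖sobEmb σ y‖ = sobNorm σ y := by
  rw [EuclideanSpace.norm_eq, sobNorm]
  congr 1
  refine sum_congr rfl fun j _ => ?_
  rw [sobEmb_apply, norm_mul, Complex.norm_real, mul_pow, Real.norm_eq_abs, sq_abs,
    ← Real.rpow_natCast, ← Real.rpow_mul (wt_pos j).le, mul_comm σ]
  simp [wt]

theorem sobNorm_sq (σ : ℝ) (y : Coeff K) :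
    sobNorm σ y ^ 2 = ∑ j, (wt j ^ σ * ‖y j‖) ^ 2 := by
  rw [← norm_sobEmb, EuclideanSpace.norm_sq_eq]
  refine sum_congr rfl fun j _ => ?_
  rw [sobEmb_apply, norm_mul, Complex.norm_real, Real.norm_eq_abs,
    abs_of_pos (Real.rpow_pos_of_pos (wt_pos j) _)]

theorem sobNorm_nonneg (σ : ℝ) (y : Coeff K) : 0 ≤ sobNorm σ y := Real.sqrt_nonneg _

theorem sobNorm_le_of_sq {σ C : ℝ} {y : Coeff K} (hC : 0 ≤ C)
    (h : ∑ j, (wt j ^ σ * ‖y j‖) ^ 2 ≤ C ^ 2) : sobNorm σ y ≤ C :=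
  (sq_le_sq₀ (sobNorm_nonneg _ _) hC).1 (by rwa [sobNorm_sq])

theorem sobNorm_zero (σ : ℝ) : sobNorm σ (0 : Coeff K) = 0 := by
  rw [← norm_sobEmb, map_zero, norm_zero]

theorem sobNorm_add_le (σ : ℝ) (y z : Coeff K) :
    sobNorm σ (y + z) ≤ sobNorm σ y + sobNorm σ z := by
  simp only [← norm_sobEmb, map_add]
  exact norm_add_le _ _

theorem sobNorm_sub_le (σ : ℝ) (y z : Coeff K) :
    sobNorm σ (y - z) ≤ sobNorm σ y + sobNorm σ z := by
  simp only [← norm_sobEmb, map_sub]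
  exact norm_sub_le _ _

theorem sobNorm_smul (σ c : ℝ) (y : Coeff K) : sobNorm σ (c • y) = |c| * sobNorm σ y := by
  simp only [← norm_sobEmb, map_smul, norm_smul, Real.norm_eq_abs]

theorem sobNorm_sum_le {ι : Type*} (σ : ℝ) (s : Finset ι) (y : ι → Coeff K) :
    sobNorm σ (∑ i ∈ s, y i) ≤ ∑ i ∈ s, sobNorm σ (y i) := by
  simp only [← norm_sobEmb, map_sum]
  exact norm_sum_le _ _

/-- A pointwise bound by a weighted multiple gives a bound of the norms. -/
theorem sobNorm_le_mul_of_le {σ τ C : ℝ} {y z : Coeff K} (hC : 0 ≤ C)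
    (h : ∀ j, wt j ^ σ * ‖y j‖ ≤ C * (wt j ^ τ * ‖z j‖)) :
    sobNorm σ y ≤ C * sobNorm τ z := by
  refine sobNorm_le_of_sq (mul_nonneg hC (sobNorm_nonneg _ _)) ?_
  rw [mul_pow, sobNorm_sq, mul_sum]
  refine sum_le_sum fun j _ => ?_
  rw [← mul_pow]
  exact pow_le_pow_left₀
    (mul_nonneg (Real.rpow_pos_of_pos (wt_pos j) σ).le (norm_nonneg _)) (h j) 2

theorem sobNorm_mono {σ τ : ℝ} (h : σ ≤ τ) (y : Coeff K) : sobNorm σ y ≤ sobNorm τ y := by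
  rw [← one_mul (sobNorm τ y)]
  refine sobNorm_le_mul_of_le zero_le_one fun j => ?_
  rw [one_mul]
  gcongr
  exact one_le_wt j

/-- Diagonal multipliers of order `b` map `H^(σ+b)` to `H^σ`. -/
theorem sobNorm_diag_le {σ b C : ℝ} {m : Modes K → ℝ} (hC : 0 ≤ C)
    (hm : ∀ j, |m j| ≤ C * wt j ^ b) (y : Coeff K) :
    sobNorm σ (fun j => (m j : ℂ) * y j) ≤ C * sobNorm (σ + b) y := by
  refine sobNorm_le_mul_of_le hC fun j => ?_
  rw [norm_mul, Complex.norm_real, Real.norm_eq_abs, Real.rpow_add (wt_pos j)]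
  have := mul_le_mul_of_nonneg_left (hm j)
    (mul_nonneg (Real.rpow_pos_of_pos (wt_pos j) σ).le (norm_nonneg (y j)))
  linarith

/-- Convergence of `∑ n⁻²` over the integers: this is what makes one derivative worth an `ℓ²`
summation uniformly in `K`. The square on the right suits Cauchy–Schwarz. -/
theorem exists_sum_wt_inv_sq_le : ∃ C : ℝ, 1 ≤ C ∧ ∀ K : ℕ,
    ∑ j : Modes K, (wt j)⁻¹ ^ 2 ≤ C ^ 2 := by
  have hs : Summable fun n : ℤ => (max 1 |(n : ℝ)|)⁻¹ ^ 2 := by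
    have h1 : Summable fun n : ℤ => 1 / (n : ℝ) ^ 2 :=
      Real.summable_one_div_int_pow.2 one_lt_two
    have h2 : Summable fun n : ℤ => if n = 0 then (1 : ℝ) else 0 :=
      summable_of_hasFiniteSupport (Set.Finite.subset (Set.finite_singleton 0) fun n hn => by
        by_contra h; simp_all)
    refine Summable.of_nonneg_of_le (fun n => by positivity) (fun n => ?_) (h1.add h2)
    by_cases hn : n = 0
    · simp [hn]
    · have : (1 : ℝ) ≤ |(n : ℝ)| := by exact_mod_cast Int.one_le_abs hn
      rw [max_eq_right this]
      simp [hn]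
  refine ⟨1 + ∑' n : ℤ, (max 1 |(n : ℝ)|)⁻¹ ^ 2, ?_, fun K => ?_⟩
  · linarith [tsum_nonneg (L := .unconditional ℤ)
      fun n : ℤ => (by positivity : (0 : ℝ) ≤ (max 1 |(n : ℝ)|)⁻¹ ^ 2)]
  · have h0 : 0 ≤ ∑' n : ℤ, (max 1 |(n : ℝ)|)⁻¹ ^ 2 :=
      tsum_nonneg fun n : ℤ => by positivity
    have h1 : ∑ j : Modes K, (wt j)⁻¹ ^ 2 ≤ ∑' n : ℤ, (max 1 |(n : ℝ)|)⁻¹ ^ 2 := by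
      have : ∑ j : Modes K, (wt j)⁻¹ ^ 2
          = ∑ n ∈ Finset.Ico (-(K : ℤ)) (K : ℤ), (max 1 |(n : ℝ)|)⁻¹ ^ 2 :=
        Finset.sum_coe_sort (Finset.Ico (-(K : ℤ)) (K : ℤ)) fun n : ℤ => (max 1 |(n : ℝ)|)⁻¹ ^ 2
      rw [this]
      exact hs.sum_le_tsum _ fun n _ => by positivity
    nlinarith

/-- The indicator of `k + l ≡ j mod 2K`. -/
def ind (k l j : Modes K) : ℝ := if (k : ℤ) + l ≡ j [ZMOD 2 * (K : ℤ)] then 1 else 0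

theorem ind_nonneg (k l j : Modes K) : 0 ≤ ind k l j := by
  unfold ind; split_ifs <;> norm_num

theorem ind_comm (k l j : Modes K) : ind k l j = ind l k j := by
  unfold ind; rw [add_comm]

theorem existsUnique_modes (hK : 1 ≤ K) (n : ℤ) : ∃! j : Modes K, n ≡ j [ZMOD 2 * (K : ℤ)] := by
  have hpos : (0 : ℤ) < 2 * K := by omega
  have h1 := Int.emod_nonneg (n + K) hpos.ne'
  have h2 := Int.emod_lt_of_pos (n + K) hpos
  refine ⟨⟨(n + K) % (2 * K) - K, by rw [Finset.mem_Ico]; omega⟩, ?_, ?_⟩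
  · have := (Int.mod_modEq (n + K) (2 * K)).symm.sub_right (K : ℤ)
    simpa using this
  · rintro ⟨j, hj⟩ h
    rw [Finset.mem_Ico] at hj
    have h3 : (n + K) % (2 * K) = (j + K) % (2 * K) := h.add_right (K : ℤ)
    rw [Int.emod_eq_of_lt (a := j + K) (by omega) (by omega)] at h3
    ext
    change j = _
    simp only
    omega

theorem sum_ite_modEq {R : Type*} [AddCommMonoid R] (hK : 1 ≤ K) (n : ℤ) (r : R) :
    ∑ j : Modes K, (if n ≡ j [ZMOD 2 * (K : ℤ)] then r else 0) = r := by
  obtain ⟨j, hj, hu⟩ := existsUnique_modes hK n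
  rw [Finset.sum_eq_single j, if_pos hj]
  · exact fun i _ hi => if_neg fun h => hi (hu i h)
  · simp

theorem sum_ind_right (hK : 1 ≤ K) (k l : Modes K) : ∑ j, ind k l j = 1 :=
  sum_ite_modEq hK _ _

theorem add_modEq_iff_sub_modEq {n k l j : ℤ} : k + l ≡ j [ZMOD n] ↔ j - k ≡ l [ZMOD n] := by
  rw [Int.modEq_iff_dvd, Int.modEq_iff_dvd, ← dvd_neg]
  ring_nf

theorem sum_ind_mid (hK : 1 ≤ K) (k j : Modes K) : ∑ l, ind k l j = 1 := by
  rw [← sum_ite_modEq hK ((j : ℤ) - k) (1 : ℝ)]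
  refine sum_congr rfl fun l _ => ?_
  simp only [ind, add_modEq_iff_sub_modEq]

theorem sum_ind_left (hK : 1 ≤ K) (l j : Modes K) : ∑ k, ind k l j = 1 := by
  simp_rw [ind_comm _ l]
  exact sum_ind_mid hK l j

/-- If `a ≠ b`, then `|b - a| ≥ 2K` forces `|a| ≥ K ≥ |b|`. Hence folding a sum of frequencies back
into the index set only lowers its modulus, and the weights obey the same triangle inequalities as
without aliasing. -/
theorem abs_le_of_modEq {a b : ℤ} (h : a ≡ b [ZMOD 2 * (K : ℤ)]) (hb : |b| ≤ K) : |b| ≤ |a| := by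
  obtain ⟨m, hm⟩ := h.dvd
  rcases eq_or_ne m 0 with rfl | h0
  · have : b = a := by linarith
    rw [this]
  · have h1 := Int.one_le_abs h0
    have h2 : 2 * (K : ℤ) ≤ |b - a| := by
      rw [hm, abs_mul, abs_of_nonneg (by positivity : (0 : ℤ) ≤ 2 * K)]
      nlinarith
    have h3 := abs_sub b a
    omega

theorem abs_modes_le (j : Modes K) : |(j : ℤ)| ≤ K := by
  have h := Finset.mem_Ico.1 j.2
  exact abs_le.2 ⟨h.1, h.2.le⟩

theorem wt_le_add {k l j : Modes K} (h : (k : ℤ) + l ≡ j [ZMOD 2 * (K : ℤ)]) :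
    wt j ≤ wt k + wt l := by
  have h1 : |(j : ℤ)| ≤ |(k : ℤ)| + |(l : ℤ)| :=
    (abs_le_of_modEq h (abs_modes_le j)).trans (abs_add_le _ _)
  have h2 : |((j : ℤ) : ℝ)| ≤ |((k : ℤ) : ℝ)| + |((l : ℤ) : ℝ)| := by exact_mod_cast h1
  refine max_le (by linarith [one_le_wt k, one_le_wt l]) (h2.trans ?_)
  exact add_le_add (le_max_right _ _) (le_max_right _ _)

theorem wt_le_add' {k l j : Modes K} (h : (k : ℤ) + l ≡ j [ZMOD 2 * (K : ℤ)]) :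
    wt l ≤ wt k + wt j := by
  have h' : (j : ℤ) - k ≡ l [ZMOD 2 * (K : ℤ)] := add_modEq_iff_sub_modEq.1 h
  have h1 : |(l : ℤ)| ≤ |(k : ℤ)| + |(j : ℤ)| :=
    (abs_le_of_modEq h' (abs_modes_le l)).trans ((abs_sub _ _).trans (add_comm _ _).le)
  have h2 : |((l : ℤ) : ℝ)| ≤ |((k : ℤ) : ℝ)| + |((j : ℤ) : ℝ)| := by exact_mod_cast h1
  refine max_le (by linarith [one_le_wt k, one_le_wt j]) (h2.trans ?_)
  exact add_le_add (le_max_right _ _) (le_max_right _ _)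

/-- Peetre's inequality. -/
theorem wt_rpow_le (τ : ℝ) {k l j : Modes K} (h : (k : ℤ) + l ≡ j [ZMOD 2 * (K : ℤ)]) :
    wt j ^ τ ≤ 2 ^ |τ| * (wt k ^ |τ| * wt l ^ τ) := by
  have hk := wt_pos k
  have hl := wt_pos l
  have hj := wt_pos j
  rcases le_total 0 τ with h0 | h0
  · rw [abs_of_nonneg h0, ← Real.mul_rpow hk.le hl.le, ← Real.mul_rpow (by norm_num) (by positivity)]
    refine Real.rpow_le_rpow hj.le ?_ h0
    nlinarith [wt_le_add h, one_le_wt k, one_le_wt l]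
  · rw [abs_of_nonpos h0]
    -- For a negative exponent the roles of `l` and `j` are exchanged; multiplying by `wt j ^ τ * wt
    -- l ^ τ` then restores the claimed form.
    have h1 : wt l ^ (-τ) ≤ 2 ^ (-τ) * (wt k ^ (-τ) * wt j ^ (-τ)) := by
      rw [← Real.mul_rpow hk.le hj.le, ← Real.mul_rpow (by norm_num) (by positivity)]
      refine Real.rpow_le_rpow hl.le ?_ (by linarith)
      nlinarith [wt_le_add' h, one_le_wt k, one_le_wt j]
    have hjt := Real.rpow_pos_of_pos hj τ
    have hlt := Real.rpow_pos_of_pos hl τ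
    have h2 := mul_le_mul_of_nonneg_left h1 (mul_pos hjt hlt).le
    have e1 : wt l ^ τ * wt l ^ (-τ) = 1 := by
      rw [← Real.rpow_add hl]; simp
    have e2 : wt j ^ τ * wt j ^ (-τ) = 1 := by
      rw [← Real.rpow_add hj]; simp
    calc wt j ^ τ = wt j ^ τ * wt l ^ τ * wt l ^ (-τ) := by rw [mul_assoc, e1, mul_one]
      _ ≤ _ := h2
      _ = 2 ^ (-τ) * (wt k ^ (-τ) * wt l ^ τ) * (wt j ^ τ * wt j ^ (-τ)) := by ring
      _ = _ := by rw [e2, mul_one]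

/-- The weight at `j` is at most twice the larger of the other two. Unlike in Peetre's inequality,
each term loads all `r` derivatives on one factor, which is what the algebra property needs. -/
theorem wt_rpow_le_add {r : ℝ} (hr : 0 ≤ r) {k l j : Modes K}
    (h : (k : ℤ) + l ≡ j [ZMOD 2 * (K : ℤ)]) :
    wt j ^ r ≤ 2 ^ r * (wt k ^ r + wt l ^ r) := by
  have hk := Real.rpow_pos_of_pos (wt_pos k) r
  have hl := Real.rpow_pos_of_pos (wt_pos l) r
  have h2 : (0 : ℝ) < 2 ^ r := Real.rpow_pos_of_pos two_pos r
  rcases le_total (wt k) (wt l) with h1 | h1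
  · calc wt j ^ r ≤ (2 * wt l) ^ r :=
          Real.rpow_le_rpow (wt_pos j).le (by linarith [wt_le_add h]) hr
      _ = 2 ^ r * wt l ^ r := Real.mul_rpow two_pos.le (wt_pos l).le
      _ ≤ _ := by nlinarith
  · calc wt j ^ r ≤ (2 * wt k) ^ r :=
          Real.rpow_le_rpow (wt_pos j).le (by linarith [wt_le_add h]) hr
      _ = 2 ^ r * wt k ^ r := Real.mul_rpow two_pos.le (wt_pos k).le
      _ ≤ _ := by nlinarith

/-- The convolution of nonnegative sequences. -/
def rconv (a b : Modes K → ℝ) (j : Modes K) : ℝ := ∑ k, ∑ l, ind k l j * (a k * b l)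

theorem norm_conv_le (y z : Coeff K) (j : Modes K) :
    ‖conv y z j‖ ≤ rconv (fun k => ‖y k‖) (fun l => ‖z l‖) j := by
  unfold conv rconv
  refine (norm_sum_le _ _).trans (sum_le_sum fun k _ => (norm_sum_le _ _).trans
    (sum_le_sum fun l _ => ?_))
  unfold ind
  split_ifs <;> simp

/-- Weights distribute over convolutions when they do so over resonant triples. -/
theorem mul_rconv_le {a b a' b' : Modes K → ℝ} {j : Modes K} {C D : ℝ}
    (h : ∀ k l : Modes K, (k : ℤ) + l ≡ j [ZMOD 2 * (K : ℤ)] →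
      C * (a k * b l) ≤ D * (a' k * b' l)) :
    C * rconv a b j ≤ D * rconv a' b' j := by
  unfold rconv
  simp only [mul_sum]
  refine sum_le_sum fun k _ => sum_le_sum fun l _ => ?_
  unfold ind
  split_ifs with hk
  · simpa using h k l hk
  · simp

/-- Cauchy–Schwarz over resonant pairs: for fixed `j`, either index determines the other. This is
the embedding of `ℓ² ∗ ℓ²` into `ℓ^∞`. -/
theorem rconv_le_sqrt (hK : 1 ≤ K) (a b : Modes K → ℝ) (j : Modes K) :
    rconv a b j ^ 2 ≤ (∑ k, a k ^ 2) * ∑ l, b l ^ 2 := by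
  have e1 : ∑ x : Modes K × Modes K, ind x.1 x.2 j * a x.1 ^ 2 = ∑ k, a k ^ 2 := by
    rw [Fintype.sum_prod_type]
    simp_rw [← sum_mul, sum_ind_mid hK, one_mul]
  have e2 : ∑ x : Modes K × Modes K, ind x.1 x.2 j * b x.2 ^ 2 = ∑ k, b k ^ 2 := by
    rw [Fintype.sum_prod_type, sum_comm]
    simp_rw [← sum_mul, sum_ind_left hK, one_mul]
  have e3 : rconv a b j = ∑ x : Modes K × Modes K, ind x.1 x.2 j * (a x.1 * b x.2) := by
    rw [Fintype.sum_prod_type]; rfl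
  rw [← e1, ← e2, e3]
  refine sum_sq_le_sum_mul_sum_of_sq_le_mul _ (fun x _ => ?_) (fun x _ => ?_) fun x _ => ?_
  · exact mul_nonneg (ind_nonneg _ _ _) (sq_nonneg _)
  · exact mul_nonneg (ind_nonneg _ _ _) (sq_nonneg _)
  · exact le_of_eq (by ring)

/-- Young's inequality `ℓ¹ ∗ ℓ² ⊆ ℓ²`. -/
theorem sum_rconv_sq_le (hK : 1 ≤ K) {a : Modes K → ℝ} (ha : ∀ k, 0 ≤ a k) (b : Modes K → ℝ) :
    ∑ j, rconv a b j ^ 2 ≤ (∑ k, a k) ^ 2 * ∑ l, b l ^ 2 := by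
  -- Cauchy–Schwarz with `a` split evenly between the factors; the subsequent sum over `j` removes
  -- the indicator.
  have h1 : ∀ j, rconv a b j ^ 2 ≤ (∑ k, a k) * ∑ k, ∑ l, ind k l j * (a k * b l ^ 2) := by
    intro j
    have e1 : ∑ x : Modes K × Modes K, ind x.1 x.2 j * a x.1 = ∑ k, a k := by
      rw [Fintype.sum_prod_type]
      simp_rw [← sum_mul, sum_ind_mid hK, one_mul]
    have e2 : ∑ k, ∑ l, ind k l j * (a k * b l ^ 2)
        = ∑ x : Modes K × Modes K, ind x.1 x.2 j * (a x.1 * b x.2 ^ 2) := by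
      rw [Fintype.sum_prod_type]
    have e3 : rconv a b j = ∑ x : Modes K × Modes K, ind x.1 x.2 j * (a x.1 * b x.2) := by
      rw [Fintype.sum_prod_type]; rfl
    rw [← e1, e2, e3]
    refine sum_sq_le_sum_mul_sum_of_sq_le_mul _ (fun x _ => ?_) (fun x _ => ?_) fun x _ => ?_
    · exact mul_nonneg (ind_nonneg _ _ _) (ha _)
    · exact mul_nonneg (ind_nonneg _ _ _) (mul_nonneg (ha _) (sq_nonneg _))
    · exact le_of_eq (by ring)
  refine (sum_le_sum fun j _ => h1 j).trans (le_of_eq ?_)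
  rw [← mul_sum, sq, mul_assoc]
  congr 1
  rw [sum_comm, sum_mul]
  refine sum_congr rfl fun k _ => ?_
  rw [sum_comm, mul_sum]
  refine sum_congr rfl fun l _ => ?_
  rw [← sum_mul, sum_ind_right hK, one_mul]

theorem rconv_comm (a b : Modes K → ℝ) (j : Modes K) : rconv a b j = rconv b a j := by
  unfold rconv
  rw [sum_comm]
  refine sum_congr rfl fun k _ => sum_congr rfl fun l _ => ?_
  rw [ind_comm, mul_comm (a l)]

end SemiWave

end

/-! ### Product estimates and Lipschitz bounds of the nonlinearity. -/

noncomputable section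

namespace SemiWave

open Finset

variable {K : ℕ}

/-- A bound of the `ℓ²` norm of the inverse weights that is uniform in `K`. -/
def wtConst : ℝ := Classical.choose exists_sum_wt_inv_sq_le

theorem one_le_wtConst : 1 ≤ wtConst := (Classical.choose_spec exists_sum_wt_inv_sq_le).1

theorem sum_wt_inv_sq_le (K : ℕ) : ∑ j : Modes K, (wt j)⁻¹ ^ 2 ≤ wtConst ^ 2 :=
  (Classical.choose_spec exists_sum_wt_inv_sq_le).2 K

theorem wtConst_nonneg : 0 ≤ wtConst := zero_le_one.trans one_le_wtConst

theorem two_rpow_nonneg (r : ℝ) : (0 : ℝ) ≤ 2 ^ r := (Real.rpow_pos_of_pos two_pos r).le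

theorem wt_rpow_nonneg (σ : ℝ) (j : Modes K) : 0 ≤ wt j ^ σ :=
  (Real.rpow_pos_of_pos (wt_pos j) σ).le

/-- Cauchy–Schwarz against the inverse weights: one derivative buys passage from `ℓ²` to `ℓ¹`. -/
theorem sum_wt_rpow_mul_le (σ : ℝ) (y : Coeff K) :
    ∑ j, wt j ^ σ * ‖y j‖ ≤ wtConst * sobNorm (σ + 1) y := by
  have h0 : ∀ j : Modes K, wt j ^ σ * ‖y j‖ = (wt j)⁻¹ * (wt j ^ (σ + 1) * ‖y j‖) := fun j => by
    rw [Real.rpow_add (wt_pos j), Real.rpow_one]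
    field_simp [(wt_pos j).ne']
  have h1 := sum_mul_sq_le_sq_mul_sq univ (fun j : Modes K => (wt j)⁻¹)
    fun j => wt j ^ (σ + 1) * ‖y j‖
  rw [← sobNorm_sq] at h1
  simp only [← h0] at h1
  refine abs_le_of_sq_le_sq' ?_ (mul_nonneg wtConst_nonneg (sobNorm_nonneg _ _)) |>.2
  rw [mul_pow]
  exact h1.trans (mul_le_mul_of_nonneg_right (sum_wt_inv_sq_le K) (sq_nonneg _))

/-- The product maps `H^|τ| × H^τ` to `H^(τ-1)`. -/
theorem sobNorm_conv_le_sub_one (hK : 1 ≤ K) (τ : ℝ) (y z : Coeff K) :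
    sobNorm (τ - 1) (conv y z) ≤ wtConst * 2 ^ |τ| * (sobNorm |τ| y * sobNorm τ z) := by
  have hn := mul_nonneg (sobNorm_nonneg |τ| y) (sobNorm_nonneg τ z)
  have hc := mul_nonneg wtConst_nonneg (two_rpow_nonneg |τ|)
  refine sobNorm_le_of_sq (mul_nonneg hc hn) ?_
  -- Only a pointwise bound of `wt j ^ τ` times the product is available; the derivative given up in
  -- the target norm supplies the summable factor `(wt j)⁻¹ ^ 2`.
  have h1 : ∀ j : Modes K, (wt j ^ (τ - 1) * ‖conv y z j‖) ^ 2
      ≤ (wt j)⁻¹ ^ 2 * (2 ^ |τ| * (sobNorm |τ| y * sobNorm τ z)) ^ 2 := by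
    intro j
    have h2 : wt j ^ τ * rconv (fun k => ‖y k‖) (fun l => ‖z l‖) j
        ≤ 2 ^ |τ| * rconv (fun k => wt k ^ |τ| * ‖y k‖) (fun l => wt l ^ τ * ‖z l‖) j := by
      refine mul_rconv_le fun k l h => ?_
      have := mul_le_mul_of_nonneg_right (wt_rpow_le τ h)
        (mul_nonneg (norm_nonneg (y k)) (norm_nonneg (z l)))
      linarith
    have h3 : rconv (fun k => wt k ^ |τ| * ‖y k‖) (fun l => wt l ^ τ * ‖z l‖) j
        ≤ sobNorm |τ| y * sobNorm τ z := by
      refine abs_le_of_sq_le_sq' ?_ hn |>.2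
      rw [mul_pow, sobNorm_sq, sobNorm_sq]
      exact rconv_le_sqrt hK _ _ j
    have h4 : wt j ^ τ * ‖conv y z j‖ ≤ 2 ^ |τ| * (sobNorm |τ| y * sobNorm τ z) :=
      (mul_le_mul_of_nonneg_left (norm_conv_le y z j) (wt_rpow_nonneg τ j)).trans
        (h2.trans (mul_le_mul_of_nonneg_left h3 (two_rpow_nonneg _)))
    rw [← mul_pow]
    refine pow_le_pow_left₀ (mul_nonneg (wt_rpow_nonneg _ j) (norm_nonneg _)) ?_ 2
    rw [Real.rpow_sub (wt_pos j), Real.rpow_one, div_eq_inv_mul, mul_assoc]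
    exact mul_le_mul_of_nonneg_left h4 (inv_nonneg.2 (wt_pos j).le)
  refine (sum_le_sum fun j _ => h1 j).trans ?_
  rw [← sum_mul, mul_assoc, mul_pow wtConst]
  exact mul_le_mul_of_nonneg_right (sum_wt_inv_sq_le K) (sq_nonneg _)

/-- The product maps `H^(s+1) × H^s` to `H^s` for `0 ≤ s`. -/
theorem sobNorm_conv_le (hK : 1 ≤ K) {s : ℝ} (hs : 0 ≤ s) (y z : Coeff K) :
    sobNorm s (conv y z) ≤ wtConst * 2 ^ s * (sobNorm (s + 1) y * sobNorm s z) := by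
  have hn := mul_nonneg (sobNorm_nonneg (s + 1) y) (sobNorm_nonneg s z)
  have hc := mul_nonneg wtConst_nonneg (two_rpow_nonneg s)
  refine sobNorm_le_of_sq (mul_nonneg hc hn) ?_
  have h1 : ∀ j : Modes K, (wt j ^ s * ‖conv y z j‖) ^ 2
      ≤ (2 ^ s) ^ 2 * rconv (fun k => wt k ^ s * ‖y k‖) (fun l => wt l ^ s * ‖z l‖) j ^ 2 := by
    intro j
    rw [← mul_pow]
    refine pow_le_pow_left₀ (mul_nonneg (wt_rpow_nonneg _ j) (norm_nonneg _)) ?_ 2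
    refine (mul_le_mul_of_nonneg_left (norm_conv_le y z j) (wt_rpow_nonneg s j)).trans ?_
    refine mul_rconv_le fun k l h => ?_
    have h2 := wt_rpow_le s h
    rw [abs_of_nonneg hs] at h2
    have := mul_le_mul_of_nonneg_right h2 (mul_nonneg (norm_nonneg (y k)) (norm_nonneg (z l)))
    linarith
  refine (sum_le_sum fun j _ => h1 j).trans ?_
  rw [← mul_sum]
  have h2 := sum_rconv_sq_le hK (a := fun k : Modes K => wt k ^ s * ‖y k‖)
    (fun k => mul_nonneg (wt_rpow_nonneg _ k) (norm_nonneg _)) fun l => wt l ^ s * ‖z l‖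
  rw [← sobNorm_sq] at h2
  have h3 : (∑ k, wt k ^ s * ‖y k‖) ^ 2 ≤ (wtConst * sobNorm (s + 1) y) ^ 2 :=
    pow_le_pow_left₀ (sum_nonneg fun k _ => mul_nonneg (wt_rpow_nonneg _ k) (norm_nonneg _))
      (sum_wt_rpow_mul_le s y) 2
  calc _ ≤ (2 ^ s) ^ 2 * ((wtConst * sobNorm (s + 1) y) ^ 2 * sobNorm s z ^ 2) :=
        mul_le_mul_of_nonneg_left (h2.trans (mul_le_mul_of_nonneg_right h3 (sq_nonneg _)))
          (sq_nonneg _)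
    _ = _ := by ring

/-- `H^r` is an algebra for `1 ≤ r`. -/
theorem sobNorm_conv_le_self (hK : 1 ≤ K) {r : ℝ} (hr : 1 ≤ r) (y z : Coeff K) :
    sobNorm r (conv y z) ≤ 2 * wtConst * 2 ^ r * (sobNorm r y * sobNorm r z) := by
  have hn := mul_nonneg (sobNorm_nonneg r y) (sobNorm_nonneg r z)
  have hc := mul_nonneg (mul_nonneg two_pos.le wtConst_nonneg) (two_rpow_nonneg r)
  refine sobNorm_le_of_sq (mul_nonneg hc hn) ?_
  have h1 : ∀ j : Modes K, (wt j ^ r * ‖conv y z j‖) ^ 2 ≤ 2 * (2 ^ r) ^ 2 *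
      (rconv (fun k => ‖z k‖) (fun l => wt l ^ r * ‖y l‖) j ^ 2 +
        rconv (fun k => ‖y k‖) (fun l => wt l ^ r * ‖z l‖) j ^ 2) := by
    intro j
    have h2 : wt j ^ r * ‖conv y z j‖ ≤ 2 ^ r * (rconv (fun k => ‖z k‖) (fun l => wt l ^ r * ‖y l‖) j
        + rconv (fun k => ‖y k‖) (fun l => wt l ^ r * ‖z l‖) j) := by
      refine (mul_le_mul_of_nonneg_left (norm_conv_le y z j) (wt_rpow_nonneg r j)).trans ?_
      rw [rconv_comm (fun k => ‖z k‖)]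
      unfold rconv
      simp only [← sum_add_distrib, mul_sum]
      refine sum_le_sum fun k _ => sum_le_sum fun l _ => ?_
      unfold ind
      split_ifs with h
      · have := mul_le_mul_of_nonneg_right (wt_rpow_le_add (zero_le_one.trans hr) h)
          (mul_nonneg (norm_nonneg (y k)) (norm_nonneg (z l)))
        linarith
      · simp
    have h3 := pow_le_pow_left₀ (mul_nonneg (wt_rpow_nonneg _ j) (norm_nonneg _)) h2 2
    refine h3.trans ?_
    rw [mul_pow, mul_comm 2, mul_assoc]
    exact mul_le_mul_of_nonneg_left (add_sq_le) (sq_nonneg _)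
  have key : ∀ u v : Coeff K, ∑ j, rconv (fun k => ‖u k‖) (fun l => wt l ^ r * ‖v l‖) j ^ 2
      ≤ (wtConst * sobNorm r u) ^ 2 * sobNorm r v ^ 2 := by
    intro u v
    have h2 := sum_rconv_sq_le hK (a := fun k : Modes K => ‖u k‖) (fun k => norm_nonneg _)
      fun l => wt l ^ r * ‖v l‖
    rw [← sobNorm_sq] at h2
    refine h2.trans (mul_le_mul_of_nonneg_right ?_ (sq_nonneg _))
    refine pow_le_pow_left₀ (sum_nonneg fun k _ => norm_nonneg _) ?_ 2
    have h3 := sum_wt_rpow_mul_le 0 u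
    simp only [Real.rpow_zero, one_mul, zero_add] at h3
    exact h3.trans (mul_le_mul_of_nonneg_left (sobNorm_mono hr u) wtConst_nonneg)
  refine (sum_le_sum fun j _ => h1 j).trans ?_
  rw [← mul_sum, sum_add_distrib]
  calc _ ≤ 2 * (2 ^ r) ^ 2 * ((wtConst * sobNorm r z) ^ 2 * sobNorm r y ^ 2 +
        (wtConst * sobNorm r y) ^ 2 * sobNorm r z ^ 2) :=
        mul_le_mul_of_nonneg_left (add_le_add (key z y) (key y z)) (by positivity)
    _ = _ := by ring

theorem conv_comm (y z : Coeff K) : conv y z = conv z y := by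
  funext j
  unfold conv
  rw [sum_comm]
  refine sum_congr rfl fun k _ => sum_congr rfl fun l _ => ?_
  rw [add_comm (l : ℤ), mul_comm (y l)]

theorem sum_ite_zero' {ι R : Type*} [AddCommMonoid R] (q : Prop) [Decidable q] (s : Finset ι)
    (f : ι → R) : (if q then ∑ i ∈ s, f i else 0) = ∑ i ∈ s, if q then f i else 0 := by
  split_ifs <;> simp

/-- The intermediate index is the unique representative of its residue class, so it can be summed
out. The resulting triple sum is symmetric in its three slots, which yields associativity. -/
theorem conv_conv_apply (hK : 1 ≤ K) (a b c : Coeff K) (j : Modes K) :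
    conv (conv a b) c j = ∑ k : Modes K, ∑ i : Modes K, ∑ l : Modes K,
      if (k : ℤ) + i + l ≡ j [ZMOD 2 * (K : ℤ)] then a k * b i * c l else 0 := by
  have h : ∀ m l : Modes K, (if (m : ℤ) + l ≡ j [ZMOD 2 * (K : ℤ)] then conv a b m * c l else 0)
      = ∑ k : Modes K, ∑ i : Modes K, if (k : ℤ) + i ≡ m [ZMOD 2 * (K : ℤ)] then
        (if (k : ℤ) + i + l ≡ j [ZMOD 2 * (K : ℤ)] then a k * b i * c l else 0) else 0 := by
    intro m l
    unfold conv
    rw [sum_mul, sum_ite_zero']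
    refine sum_congr rfl fun k _ => ?_
    rw [sum_mul, sum_ite_zero']
    refine sum_congr rfl fun i _ => ?_
    by_cases h1 : (k : ℤ) + i ≡ m [ZMOD 2 * (K : ℤ)]
    · have h2 : ((k : ℤ) + i + l ≡ j [ZMOD 2 * (K : ℤ)]) ↔ ((m : ℤ) + l ≡ j [ZMOD 2 * (K : ℤ)]) :=
        ⟨fun h => (h1.add_right _).symm.trans h, fun h => (h1.add_right _).trans h⟩
      simp only [if_pos h1, h2]
    · simp [if_neg h1]
  rw [conv]
  simp only [h]
  rw [sum_comm]
  have h' : ∀ l : Modes K, (∑ m : Modes K, ∑ k : Modes K, ∑ i : Modes K,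
      if (k : ℤ) + i ≡ m [ZMOD 2 * (K : ℤ)] then
        (if (k : ℤ) + i + l ≡ j [ZMOD 2 * (K : ℤ)] then a k * b i * c l else 0) else 0)
      = ∑ k : Modes K, ∑ i : Modes K,
        if (k : ℤ) + i + l ≡ j [ZMOD 2 * (K : ℤ)] then a k * b i * c l else 0 := by
    intro l
    rw [sum_comm]
    refine sum_congr rfl fun k _ => ?_
    rw [sum_comm]
    exact sum_congr rfl fun i _ => sum_ite_modEq hK _ _
  simp only [h']
  rw [sum_comm]
  exact sum_congr rfl fun k _ => sum_comm

theorem conv_assoc (hK : 1 ≤ K) (a b c : Coeff K) : conv (conv a b) c = conv a (conv b c) := by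
  rw [conv_comm a (conv b c)]
  funext j
  rw [conv_conv_apply hK, conv_conv_apply hK, sum_comm]
  refine sum_congr rfl fun k _ => ?_
  rw [sum_comm]
  refine sum_congr rfl fun i _ => sum_congr rfl fun l _ => ?_
  rw [show (l : ℤ) + k + i = k + i + l by ring, show a l * b k * c i = b k * c i * a l by ring]

theorem conv_add_left (a b c : Coeff K) : conv (a + b) c = conv a c + conv b c := by
  funext j
  simp only [conv, Pi.add_apply, ← sum_add_distrib]
  refine sum_congr rfl fun k _ => sum_congr rfl fun l _ => ?_
  split_ifs <;> ring

theorem conv_smul_left (r : ℝ) (a c : Coeff K) : conv (r • a) c = r • conv a c := by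
  funext j
  simp only [conv, Pi.smul_apply, smul_sum]
  refine sum_congr rfl fun k _ => sum_congr rfl fun l _ => ?_
  split_ifs <;> simp [mul_assoc]

theorem conv_smul_right (r : ℝ) (a c : Coeff K) : conv a (r • c) = r • conv a c := by
  rw [conv_comm, conv_smul_left, conv_comm c]

theorem conv_sub_left (a b c : Coeff K) : conv (a - b) c = conv a c - conv b c := by
  have h : a - b = a + (-1 : ℝ) • b := by simp [sub_eq_add_neg]
  rw [h, conv_add_left, conv_smul_left]
  simp [sub_eq_add_neg]

theorem conv_sub_right (a b c : Coeff K) : conv a (b - c) = conv a b - conv a c := by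
  rw [conv_comm, conv_sub_left, conv_comm b, conv_comm c]

theorem sobNorm_nonlin_zero_le (r : ℝ) (y : Coeff K) : sobNorm r (nonlin 0 y) ≤ 1 := by
  refine sobNorm_le_of_sq zero_le_one ?_
  have h : ∀ j : Modes K, (wt j ^ r * ‖nonlin 0 y j‖) ^ 2 = if (j : ℤ) = 0 then 1 else 0 := by
    intro j
    by_cases hj : (j : ℤ) = 0 <;> simp [nonlin, hj, wt]
  simp only [h]
  have e := Finset.sum_coe_sort (Finset.Ico (-(K : ℤ)) (K : ℤ))
    fun n : ℤ => if n = 0 then (1 : ℝ) else 0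
  refine e.le.trans ?_
  rw [Finset.sum_ite_eq']
  split_ifs <;> norm_num

theorem exists_sobNorm_nonlin_le {r : ℝ} (hr : 1 ≤ r) (R : ℝ) (p : ℕ) :
    ∃ C : ℝ, 0 ≤ C ∧ ∀ K : ℕ, 1 ≤ K → ∀ y : Coeff K, sobNorm r y ≤ R →
      sobNorm r (nonlin p y) ≤ C := by
  induction p with
  | zero => exact ⟨1, zero_le_one, fun K _ y _ => sobNorm_nonlin_zero_le r y⟩
  | succ p ih =>
    obtain ⟨C, hC, h⟩ := ih
    have hc := mul_nonneg (mul_nonneg two_pos.le wtConst_nonneg) (two_rpow_nonneg r)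
    refine ⟨2 * wtConst * 2 ^ r * (|R| * C), by positivity, fun K hK y hy => ?_⟩
    refine (sobNorm_conv_le_self hK hr _ _).trans (mul_le_mul_of_nonneg_left ?_ hc)
    exact mul_le_mul (hy.trans (le_abs_self R)) (h K hK y hy) (sobNorm_nonneg _ _) (abs_nonneg _)

/-- Differences of powers factor, with a cofactor bounded in the algebra `H^r`. -/
theorem exists_nonlin_sub_eq_conv {r : ℝ} (hr : 1 ≤ r) (R : ℝ) (p : ℕ) :
    ∃ C : ℝ, 0 ≤ C ∧ ∀ K : ℕ, 1 ≤ K → ∀ y z : Coeff K, sobNorm r y ≤ R → sobNorm r z ≤ R →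
      ∃ g : Coeff K, nonlin p y - nonlin p z = conv g (y - z) ∧ sobNorm r g ≤ C := by
  induction p with
  | zero =>
    refine ⟨0, le_rfl, fun K _ y z _ _ => ⟨0, ?_, (sobNorm_zero r).le⟩⟩
    funext j
    simp [nonlin, conv]
  | succ p ih =>
    obtain ⟨C, hC, h⟩ := ih
    obtain ⟨D, hD, h'⟩ := exists_sobNorm_nonlin_le hr R p
    have hc := mul_nonneg (mul_nonneg two_pos.le wtConst_nonneg) (two_rpow_nonneg r)
    refine ⟨D + 2 * wtConst * 2 ^ r * (|R| * C), by positivity, fun K hK y z hy hz => ?_⟩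
    obtain ⟨g, hg, hgC⟩ := h K hK y z hy hz
    -- Telescoping: `y ∗ f(y) - z ∗ f(z) = f(y) ∗ (y - z) + z ∗ (f(y) - f(z))`, with `f` the lower
    -- power.
    refine ⟨nonlin p y + conv z g, ?_, (sobNorm_add_le _ _ _).trans
      (add_le_add (h' K hK y hy) ?_)⟩
    · rw [conv_add_left, conv_assoc hK, ← hg, conv_sub_right, conv_sub_right,
        conv_comm (nonlin p y) y, conv_comm (nonlin p y) z]
      simp only [nonlin]
      abel
    · refine (sobNorm_conv_le_self hK hr _ _).trans (mul_le_mul_of_nonneg_left ?_ hc)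
      exact mul_le_mul (hz.trans (le_abs_self R)) hgC (sobNorm_nonneg _ _) (abs_nonneg _)

/-- The nonlinearity is Lipschitz from `H^τ` to `H^(τ-1)` on bounded sets of `H^r`, `|τ| ≤ r`,
uniformly in `τ`. -/
theorem exists_nonlin_lipschitz {r : ℝ} (hr : 1 ≤ r) (R : ℝ) (p : ℕ) :
    ∃ L : ℝ, 0 ≤ L ∧ ∀ K : ℕ, 1 ≤ K → ∀ y z : Coeff K, sobNorm r y ≤ R → sobNorm r z ≤ R →
      ∀ τ : ℝ, |τ| ≤ r →
        sobNorm (τ - 1) (nonlin p y - nonlin p z) ≤ L * sobNorm τ (y - z) := by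
  obtain ⟨C, hC, h⟩ := exists_nonlin_sub_eq_conv hr R p
  refine ⟨wtConst * 2 ^ r * C, mul_nonneg (mul_nonneg wtConst_nonneg (two_rpow_nonneg r)) hC,
    fun K hK y z hy hz τ hτ => ?_⟩
  obtain ⟨g, hg, hgC⟩ := h K hK y z hy hz
  rw [hg]
  refine (sobNorm_conv_le_sub_one hK τ _ _).trans ?_
  rw [← mul_assoc]
  refine mul_le_mul_of_nonneg_right ?_ (sobNorm_nonneg _ _)
  have h1 : (2 : ℝ) ^ |τ| ≤ 2 ^ r := Real.rpow_le_rpow_of_exponent_le one_le_two hτ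
  have h2 := (sobNorm_mono hτ g).trans hgC
  exact mul_le_mul (mul_le_mul_of_nonneg_left h1 wtConst_nonneg) h2 (sobNorm_nonneg _ _)
    (mul_nonneg wtConst_nonneg (two_rpow_nonneg r))

end SemiWave

end

/-! ### The trapezoidal rule with diagonal kernels, and time derivatives of the nonlinearity. -/

noncomputable section

namespace SemiWave

open Finset hiding Icc
open Set

/-- The trapezoidal sum of `G` over `n` unit steps. -/
def trap {E : Type*} [AddCommGroup E] [Module ℝ E] (n : ℕ) (G : ℕ → E) : E :=
  ∑ m ∈ Finset.range n, (1 / 2 : ℝ) • (G m + G (m + 1))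

section Trapezoid

variable {E : Type*} [NormedAddCommGroup E] [NormedSpace ℝ E]

/-- Regarding the quadrature error as a function of its right endpoint turns it into a mean value
estimate: the derivative is half the first-order Taylor remainder of `G` read backwards from `t`. -/
theorem hasDerivWithinAt_trapezoid {F G H : ℝ → E} {a t : ℝ} {s : Set ℝ}
    (hF : HasDerivWithinAt F (G t) s t) (hG : HasDerivWithinAt G (H t) s t) :
    HasDerivWithinAt (fun x => F x - F a - ((x - a) / 2) • (G a + G x))
      ((1 / 2 : ℝ) • (G t - G a - (t - a) • H t)) s t := by
  have h1 : HasDerivWithinAt (fun x : ℝ => (x - a) / 2) (1 / 2) s t :=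
    ((hasDerivWithinAt_id t s).sub_const a).div_const 2
  have h2 := (hF.sub_const (F a)).fun_sub (h1.smul (hG.const_add (G a)))
  refine h2.congr_deriv ?_
  module

theorem norm_trapezoid_le {F G H : ℝ → E} {a b B : ℝ} (hab : a ≤ b)
    (hF : ∀ t ∈ Icc a b, HasDerivWithinAt F (G t) (Icc a b) t)
    (hG : ∀ t ∈ Icc a b, HasDerivWithinAt G (H t) (Icc a b) t)
    (hB : ∀ t ∈ Icc a b, ‖H t‖ ≤ B) :
    ‖F b - F a - ((b - a) / 2) • (G a + G b)‖ ≤ B * (b - a) ^ 2 := by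
  have ha : a ∈ Icc a b := left_mem_Icc.2 hab
  have hb : b ∈ Icc a b := right_mem_Icc.2 hab
  have hB0 : 0 ≤ B := (norm_nonneg _).trans (hB a ha)
  have h1 := (convex_Icc a b).norm_image_sub_le_of_norm_hasDerivWithin_le (C := B * (b - a))
    (fun t ht => hasDerivWithinAt_trapezoid (a := a) (hF t ht) (hG t ht)) ?_ ha hb
  · simpa [abs_of_nonneg (sub_nonneg.2 hab), sq, mul_assoc] using h1
  · intro t ht
    have h2 := (convex_Icc a b).norm_image_sub_le_of_norm_hasDerivWithin_le hG hB ha ht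
    have h3 : 0 ≤ t - a := sub_nonneg.2 ht.1
    have h4 : t - a ≤ b - a := sub_le_sub_right ht.2 a
    rw [Real.norm_of_nonneg h3] at h2
    have h5 : ‖(t - a) • H t‖ ≤ (t - a) * B := by
      rw [norm_smul, Real.norm_of_nonneg h3]
      exact mul_le_mul_of_nonneg_left (hB t ht) h3
    have h6 := norm_sub_le (G t - G a) ((t - a) • H t)
    rw [norm_smul]
    norm_num
    nlinarith

/-- The mean value inequality is used twice, since the Taylor remainder has itself the derivative
`-(x - a) • J x`. -/
theorem norm_trapezoid_le_cube {F G H J : ℝ → E} {a b B : ℝ} (hab : a ≤ b)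
    (hF : ∀ t ∈ Icc a b, HasDerivWithinAt F (G t) (Icc a b) t)
    (hG : ∀ t ∈ Icc a b, HasDerivWithinAt G (H t) (Icc a b) t)
    (hH : ∀ t ∈ Icc a b, HasDerivWithinAt H (J t) (Icc a b) t)
    (hB : ∀ t ∈ Icc a b, ‖J t‖ ≤ B) :
    ‖F b - F a - ((b - a) / 2) • (G a + G b)‖ ≤ B * (b - a) ^ 3 := by
  have ha : a ∈ Icc a b := left_mem_Icc.2 hab
  have hb : b ∈ Icc a b := right_mem_Icc.2 hab
  have hB0 : 0 ≤ B := (norm_nonneg _).trans (hB a ha)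
  have hba : 0 ≤ b - a := sub_nonneg.2 hab
  have h1 := (convex_Icc a b).norm_image_sub_le_of_norm_hasDerivWithin_le
    (C := B * (b - a) ^ 2)
    (fun t ht => hasDerivWithinAt_trapezoid (a := a) (hF t ht) (hG t ht)) ?_ ha hb
  · have e : B * (b - a) ^ 3 = B * (b - a) ^ 2 * (b - a) := by ring
    rw [e]
    simpa [abs_of_nonneg hba] using h1
  · intro t ht
    have h3 : 0 ≤ t - a := sub_nonneg.2 ht.1
    have h4 : t - a ≤ b - a := sub_le_sub_right ht.2 a
    have hP : ∀ x ∈ Icc a b, HasDerivWithinAt (fun x => G x - G a - (x - a) • H x)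
        (-((x - a) • J x)) (Icc a b) x := by
      intro x hx
      have h5 := ((hG x hx).sub_const (G a)).fun_sub
        (((hasDerivWithinAt_id x (Icc a b)).sub_const a).smul (hH x hx))
      refine h5.congr_deriv ?_
      simp
    have h2 := (convex_Icc a b).norm_image_sub_le_of_norm_hasDerivWithin_le
      (C := (b - a) * B) hP ?_ ha ht
    · simp only [sub_self, zero_smul, sub_zero, Real.norm_of_nonneg h3] at h2
      rw [norm_smul]
      norm_num
      nlinarith [mul_nonneg hba hB0, norm_nonneg (G t - G a - (t - a) • H t)]
    · intro x hx
      have h5 : 0 ≤ x - a := sub_nonneg.2 hx.1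
      rw [norm_neg, norm_smul, Real.norm_of_nonneg h5]
      exact mul_le_mul (sub_le_sub_right hx.2 a) (hB x hx) (norm_nonneg _) hba

theorem node_mem_Icc {t₀ T h : ℝ} (hh : 0 ≤ h) {m : ℕ} (hm : (m : ℝ) * h ≤ T) :
    t₀ + m * h ∈ Icc t₀ (t₀ + T) :=
  ⟨le_add_of_nonneg_right (by positivity), by linarith⟩

/-- Summation of quadrature errors over the steps. -/
theorem norm_sub_trap_le {F G : ℝ → E} {t₀ T h D : ℝ} (hh : 0 ≤ h)
    (hstep : ∀ a b, a ≤ b → Icc a b ⊆ Icc t₀ (t₀ + T) → b - a = h →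
      ‖F b - F a - ((b - a) / 2) • (G a + G b)‖ ≤ D) (n : ℕ) (hn : (n : ℝ) * h ≤ T) :
    ‖F (t₀ + n * h) - F t₀ - h • trap n (fun m => G (t₀ + m * h))‖ ≤ n * D := by
  induction n with
  | zero => simp [trap]
  | succ n ih =>
    push_cast at hn ⊢
    have h0 : (n : ℝ) * h ≤ T := by nlinarith
    have h1 := ih h0
    have hI := Icc_subset_Icc (node_mem_Icc (t₀ := t₀) hh h0).1
      (show t₀ + ((n : ℝ) + 1) * h ≤ t₀ + T by linarith)
    have h2 := hstep (t₀ + n * h) (t₀ + (n + 1) * h) (by nlinarith) hI (by ring)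
    rw [trap, sum_range_succ, ← trap]
    have e : F (t₀ + (n + 1) * h) - F t₀ - h • (trap n (fun m => G (t₀ + m * h)) +
        (1 / 2 : ℝ) • (G (t₀ + n * h) + G (t₀ + ((n + 1 : ℕ) : ℝ) * h)))
        = (F (t₀ + n * h) - F t₀ - h • trap n (fun m => G (t₀ + m * h))) +
          (F (t₀ + (n + 1) * h) - F (t₀ + n * h) -
            ((t₀ + (n + 1) * h - (t₀ + n * h)) / 2) •
              (G (t₀ + n * h) + G (t₀ + (n + 1) * h))) := by
      push_cast
      module
    rw [e]
    refine (norm_add_le _ _).trans ?_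
    linarith

end Trapezoid

variable {K : ℕ}

theorem hasDerivWithinAt_sobEmb (σ : ℝ) {F : ℝ → Coeff K} {F' : Coeff K} {s : Set ℝ} {t : ℝ}
    (h : HasDerivWithinAt F F' s t) :
    HasDerivWithinAt (fun t => sobEmb σ (F t)) (sobEmb σ F') s t :=
  (sobEmb σ).hasFDerivAt.comp_hasDerivWithinAt t h

theorem map_trap {E E' : Type*} [AddCommGroup E] [Module ℝ E] [AddCommGroup E'] [Module ℝ E']
    (A : E →ₗ[ℝ] E') (n : ℕ) (G : ℕ → E) : A (trap n G) = trap n fun m => A (G m) := by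
  simp [trap]

theorem sobEmb_sub_trap (σ h : ℝ) (n : ℕ) (a b : Coeff K) (G : ℕ → Coeff K) :
    sobEmb σ (a - b - h • trap n G)
      = sobEmb σ a - sobEmb σ b - h • trap n fun m => sobEmb σ (G m) := by
  rw [map_sub, map_sub, map_smul]
  congr 2
  exact map_trap (sobEmb σ).toLinearMap n G

/-- First-order error of the composite trapezoidal rule. -/
theorem sobNorm_sub_trap_le {σ t₀ T h B : ℝ} (hh : 0 ≤ h) (hT : 0 ≤ T) {F G H : ℝ → Coeff K}
    (hF : ∀ t ∈ Icc t₀ (t₀ + T), HasDerivWithinAt F (G t) (Icc t₀ (t₀ + T)) t)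
    (hG : ∀ t ∈ Icc t₀ (t₀ + T), HasDerivWithinAt G (H t) (Icc t₀ (t₀ + T)) t)
    (hB : ∀ t ∈ Icc t₀ (t₀ + T), sobNorm σ (H t) ≤ B) (n : ℕ) (hn : (n : ℝ) * h ≤ T) :
    sobNorm σ (F (t₀ + n * h) - F t₀ - h • trap n (fun m => G (t₀ + m * h))) ≤ B * T * h := by
  have hB0 : 0 ≤ B := (sobNorm_nonneg _ _).trans (hB t₀ ⟨le_rfl, by linarith⟩)
  -- The mean value estimates live in a normed space, so they are applied to the image under the
  -- isometric embedding.
  rw [← norm_sobEmb, sobEmb_sub_trap]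
  refine (norm_sub_trap_le (F := fun t => sobEmb σ (F t)) (G := fun t => sobEmb σ (G t))
    (T := T) (D := B * h ^ 2) hh (fun a b hab hI hba => ?_) n hn).trans ?_
  · rw [← hba]
    exact norm_trapezoid_le hab
      (fun t ht => (hasDerivWithinAt_sobEmb σ (hF t (hI ht))).mono hI)
      (fun t ht => (hasDerivWithinAt_sobEmb σ (hG t (hI ht))).mono hI)
      (fun t ht => by rw [norm_sobEmb]; exact hB t (hI ht))
  · nlinarith [mul_le_mul_of_nonneg_left hn (mul_nonneg hB0 hh)]

/-- Second-order error of the composite trapezoidal rule. -/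
theorem sobNorm_sub_trap_le_sq {σ t₀ T h B : ℝ} (hh : 0 ≤ h) (hT : 0 ≤ T)
    {F G H J : ℝ → Coeff K}
    (hF : ∀ t ∈ Icc t₀ (t₀ + T), HasDerivWithinAt F (G t) (Icc t₀ (t₀ + T)) t)
    (hG : ∀ t ∈ Icc t₀ (t₀ + T), HasDerivWithinAt G (H t) (Icc t₀ (t₀ + T)) t)
    (hH : ∀ t ∈ Icc t₀ (t₀ + T), HasDerivWithinAt H (J t) (Icc t₀ (t₀ + T)) t)
    (hB : ∀ t ∈ Icc t₀ (t₀ + T), sobNorm σ (J t) ≤ B) (n : ℕ) (hn : (n : ℝ) * h ≤ T) :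
    sobNorm σ (F (t₀ + n * h) - F t₀ - h • trap n (fun m => G (t₀ + m * h)))
      ≤ B * T * h ^ 2 := by
  have hB0 : 0 ≤ B := (sobNorm_nonneg _ _).trans (hB t₀ ⟨le_rfl, by linarith⟩)
  rw [← norm_sobEmb, sobEmb_sub_trap]
  refine (norm_sub_trap_le (F := fun t => sobEmb σ (F t)) (G := fun t => sobEmb σ (G t))
    (T := T) (D := B * h ^ 3) hh (fun a b hab hI hba => ?_) n hn).trans ?_
  · rw [← hba]
    exact norm_trapezoid_le_cube hab
      (fun t ht => (hasDerivWithinAt_sobEmb σ (hF t (hI ht))).mono hI)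
      (fun t ht => (hasDerivWithinAt_sobEmb σ (hG t (hI ht))).mono hI)
      (fun t ht => (hasDerivWithinAt_sobEmb σ (hH t (hI ht))).mono hI)
      (fun t ht => by rw [norm_sobEmb]; exact hB t (hI ht))
  · nlinarith [mul_le_mul_of_nonneg_left hn (mul_nonneg hB0 (sq_nonneg h))]

/-- The diagonal operator with real symbol `m`. -/
def diag (m : Modes K → ℝ) (y : Coeff K) : Coeff K := fun j => (m j : ℂ) * y j

theorem hasDerivWithinAt_diag {k k' : Modes K → ℝ → ℝ} {u : ℝ → Coeff K} {u' : Coeff K}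
    {s : Set ℝ} {t : ℝ} (hk : ∀ j, HasDerivAt (k j) (k' j t) t)
    (hu : HasDerivWithinAt u u' s t) :
    HasDerivWithinAt (fun t => diag (fun j => k j t) (u t))
      (diag (fun j => k' j t) (u t) + diag (fun j => k j t) u') s t := by
  rw [hasDerivWithinAt_pi] at hu ⊢
  intro j
  exact ((hk j).ofReal_comp.hasDerivWithinAt).mul (hu j)

/-- Quadrature error for `∫ k(t) g(t) dt` with a diagonal kernel `k` of order `a - 1` whose
derivatives are of order `a` and `a + 1`. -/
theorem sobNorm_kernel_trap_le {σ a A t₀ T h B : ℝ} (hh : 0 ≤ h) (hT : 0 ≤ T) (hA : 0 ≤ A)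
    {F g g₁ : ℝ → Coeff K} {k k₁ : Modes K → ℝ → ℝ}
    (hF : ∀ t ∈ Icc t₀ (t₀ + T),
      HasDerivWithinAt F (diag (fun j => k j t) (g t)) (Icc t₀ (t₀ + T)) t)
    (hg : ∀ t ∈ Icc t₀ (t₀ + T), HasDerivWithinAt g (g₁ t) (Icc t₀ (t₀ + T)) t)
    (hk : ∀ j t, HasDerivAt (k j) (k₁ j t) t)
    (bk : ∀ t ∈ Icc t₀ (t₀ + T), ∀ j, |k j t| ≤ A * wt j ^ (a - 1))
    (bk₁ : ∀ t ∈ Icc t₀ (t₀ + T), ∀ j, |k₁ j t| ≤ A * wt j ^ a)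
    (bg : ∀ t ∈ Icc t₀ (t₀ + T), sobNorm σ (g t) ≤ B)
    (bg₁ : ∀ t ∈ Icc t₀ (t₀ + T), sobNorm (σ - 1) (g₁ t) ≤ B) (n : ℕ) (hn : (n : ℝ) * h ≤ T) :
    sobNorm (σ - a) (F (t₀ + n * h) - F t₀ -
      h • trap n (fun m => diag (fun j => k j (t₀ + m * h)) (g (t₀ + m * h))))
      ≤ 2 * A * B * T * h := by
  refine sobNorm_sub_trap_le (B := 2 * A * B) hh hT hF
    (fun t ht => hasDerivWithinAt_diag (fun j => hk j t) (hg t ht)) (fun t ht => ?_) n hn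
  refine (sobNorm_add_le _ _ _).trans ?_
  have h1 := sobNorm_diag_le (σ := σ - a) hA (bk₁ t ht) (g t)
  have h2 := sobNorm_diag_le (σ := σ - a) hA (bk t ht) (g₁ t)
  rw [show σ - a + a = σ by ring] at h1
  rw [show σ - a + (a - 1) = σ - 1 by ring] at h2
  have h3 := mul_le_mul_of_nonneg_left (bg t ht) hA
  have h4 := mul_le_mul_of_nonneg_left (bg₁ t ht) hA
  unfold diag
  linarith

theorem sobNorm_kernel_trap_le_sq {σ a A t₀ T h B : ℝ} (hh : 0 ≤ h) (hT : 0 ≤ T) (hA : 0 ≤ A)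
    {F g g₁ g₂ : ℝ → Coeff K} {k k₁ k₂ : Modes K → ℝ → ℝ}
    (hF : ∀ t ∈ Icc t₀ (t₀ + T),
      HasDerivWithinAt F (diag (fun j => k j t) (g t)) (Icc t₀ (t₀ + T)) t)
    (hg : ∀ t ∈ Icc t₀ (t₀ + T), HasDerivWithinAt g (g₁ t) (Icc t₀ (t₀ + T)) t)
    (hg₁ : ∀ t ∈ Icc t₀ (t₀ + T), HasDerivWithinAt g₁ (g₂ t) (Icc t₀ (t₀ + T)) t)
    (hk : ∀ j t, HasDerivAt (k j) (k₁ j t) t)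
    (hk₁ : ∀ j t, HasDerivAt (k₁ j) (k₂ j t) t)
    (bk : ∀ t ∈ Icc t₀ (t₀ + T), ∀ j, |k j t| ≤ A * wt j ^ (a - 1))
    (bk₁ : ∀ t ∈ Icc t₀ (t₀ + T), ∀ j, |k₁ j t| ≤ A * wt j ^ a)
    (bk₂ : ∀ t ∈ Icc t₀ (t₀ + T), ∀ j, |k₂ j t| ≤ A * wt j ^ (a + 1))
    (bg : ∀ t ∈ Icc t₀ (t₀ + T), sobNorm (σ + 1) (g t) ≤ B)
    (bg₁ : ∀ t ∈ Icc t₀ (t₀ + T), sobNorm σ (g₁ t) ≤ B)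
    (bg₂ : ∀ t ∈ Icc t₀ (t₀ + T), sobNorm (σ - 1) (g₂ t) ≤ B)
    (n : ℕ) (hn : (n : ℝ) * h ≤ T) :
    sobNorm (σ - a) (F (t₀ + n * h) - F t₀ -
      h • trap n (fun m => diag (fun j => k j (t₀ + m * h)) (g (t₀ + m * h))))
      ≤ 4 * A * B * T * h ^ 2 := by
  refine sobNorm_sub_trap_le_sq (B := 4 * A * B) hh hT hF
    (fun t ht => hasDerivWithinAt_diag (fun j => hk j t) (hg t ht))
    (fun t ht => (hasDerivWithinAt_diag (fun j => hk₁ j t) (hg t ht)).fun_add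
      (hasDerivWithinAt_diag (fun j => hk j t) (hg₁ t ht))) (fun t ht => ?_) n hn
  have h1 := sobNorm_diag_le (σ := σ - a) hA (bk₂ t ht) (g t)
  have h2 := sobNorm_diag_le (σ := σ - a) hA (bk₁ t ht) (g₁ t)
  have h3 := sobNorm_diag_le (σ := σ - a) hA (bk t ht) (g₂ t)
  rw [show σ - a + (a + 1) = σ + 1 by ring] at h1
  rw [show σ - a + a = σ by ring] at h2
  rw [show σ - a + (a - 1) = σ - 1 by ring] at h3
  have h4 := mul_le_mul_of_nonneg_left (bg t ht) hA
  have h5 := mul_le_mul_of_nonneg_left (bg₁ t ht) hA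
  have h6 := mul_le_mul_of_nonneg_left (bg₂ t ht) hA
  have h7 := sobNorm_add_le (σ - a)
    (diag (fun j => k₂ j t) (g t) + diag (fun j => k₁ j t) (g₁ t))
    (diag (fun j => k₁ j t) (g₁ t) + diag (fun j => k j t) (g₂ t))
  have h8 := sobNorm_add_le (σ - a) (diag (fun j => k₂ j t) (g t)) (diag (fun j => k₁ j t) (g₁ t))
  have h9 := sobNorm_add_le (σ - a) (diag (fun j => k₁ j t) (g₁ t)) (diag (fun j => k j t) (g₂ t))
  unfold diag at *
  linarith

theorem hasDerivWithinAt_conv {y z : ℝ → Coeff K} {y' z' : Coeff K} {s : Set ℝ} {t : ℝ}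
    (hy : HasDerivWithinAt y y' s t) (hz : HasDerivWithinAt z z' s t) :
    HasDerivWithinAt (fun t => conv (y t) (z t)) (conv y' (z t) + conv (y t) z') s t := by
  rw [hasDerivWithinAt_pi] at hy hz ⊢
  intro j
  simp only [Pi.add_apply, conv, ← sum_add_distrib]
  refine HasDerivWithinAt.fun_sum fun k _ => HasDerivWithinAt.fun_sum fun l _ => ?_
  split_ifs
  · exact (hy k).mul (hz l)
  · simpa using hasDerivWithinAt_const t s (0 : ℂ)

/-- The derivative of `nonlin p` at `y` in direction `v`. -/
def dnonlin (p : ℕ) (y v : Coeff K) : Coeff K := (p : ℝ) • conv (nonlin (p - 1) y) v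

/-- The second derivative of `nonlin p` along a curve at `y` with velocity `v` and
acceleration `a`. -/
def ddnonlin (p : ℕ) (y v a : Coeff K) : Coeff K :=
  (p : ℝ) • (conv (dnonlin (p - 1) y v) v + conv (nonlin (p - 1) y) a)

theorem hasDerivWithinAt_nonlin (hK : 1 ≤ K) (p : ℕ) {y : ℝ → Coeff K} {v : Coeff K} {s : Set ℝ}
    {t : ℝ} (hy : HasDerivWithinAt y v s t) :
    HasDerivWithinAt (fun t => nonlin p (y t)) (dnonlin p (y t) v) s t := by
  induction p with
  | zero =>
    have h : HasDerivWithinAt (fun t => nonlin 0 (y t)) 0 s t :=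
      hasDerivWithinAt_const t s (nonlin 0 (y t))
    refine h.congr_deriv ?_
    simp [dnonlin]
  | succ p ih =>
    refine (hasDerivWithinAt_conv hy ih).congr_deriv ?_
    simp only [dnonlin, Nat.add_sub_cancel]
    rw [conv_smul_right, ← conv_assoc hK, conv_comm v]
    -- The cofactor `nonlin (p - 1)` recombines with `y` to `nonlin p` only for `1 ≤ p`; for `p = 0`
    -- the coefficient vanishes.
    rcases p with _ | p
    · simp
    · simp only [Nat.add_sub_cancel]
      rw [← nonlin]
      push_cast
      module

theorem hasDerivWithinAt_dnonlin (hK : 1 ≤ K) (p : ℕ) {y v : ℝ → Coeff K} {a : Coeff K}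
    {s : Set ℝ} {t : ℝ} (hy : HasDerivWithinAt y (v t) s t) (hv : HasDerivWithinAt v a s t) :
    HasDerivWithinAt (fun t => dnonlin p (y t) (v t)) (ddnonlin p (y t) (v t) a) s t :=
  (hasDerivWithinAt_conv (hasDerivWithinAt_nonlin hK (p - 1) hy) hv).const_smul (p : ℝ)

theorem exists_sobNorm_dnonlin_le {s : ℝ} (hs : 0 ≤ s) (R : ℝ) (p : ℕ) :
    ∃ C : ℝ, 0 ≤ C ∧ ∀ K : ℕ, 1 ≤ K → ∀ y v : Coeff K, sobNorm (s + 1) y ≤ R → sobNorm s v ≤ R →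
      sobNorm s (dnonlin p y v) ≤ C := by
  obtain ⟨C, hC, h⟩ := exists_sobNorm_nonlin_le (r := s + 1) (by linarith) R (p - 1)
  have hc := mul_nonneg wtConst_nonneg (two_rpow_nonneg s)
  refine ⟨p * (wtConst * 2 ^ s * (C * |R|)), by positivity, fun K hK y v hy hv => ?_⟩
  rw [dnonlin, sobNorm_smul, abs_of_nonneg (Nat.cast_nonneg p)]
  refine mul_le_mul_of_nonneg_left ((sobNorm_conv_le hK hs _ _).trans
    (mul_le_mul_of_nonneg_left ?_ hc)) (Nat.cast_nonneg p)
  exact mul_le_mul (h K hK y hy) (hv.trans (le_abs_self R)) (sobNorm_nonneg _ _) hC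

/-- Bounds of the nonlinearity and its first two time derivatives along finite-energy solutions. -/
theorem exists_sobNorm_deriv_nonlin_le {s : ℝ} (hs : 0 ≤ s) (M : ℝ) (p : ℕ) :
    ∃ C : ℝ, 0 ≤ C ∧ ∀ K : ℕ, 1 ≤ K → ∀ (W : Modes K → ℝ) (y v : Coeff K),
      (∀ j, |W j| ≤ 2 * wt j) → sobNorm (s + 1) y + sobNorm s v ≤ M →
      sobNorm (s + 1) (nonlin p y) ≤ C ∧ sobNorm s (dnonlin p y v) ≤ C ∧
      sobNorm (s - 2) (ddnonlin p y v (fun j => -((W j : ℂ) ^ 2 * y j) + nonlin p y j)) ≤ C := by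
  obtain ⟨C₁, hC₁, h₁⟩ := exists_sobNorm_nonlin_le (r := s + 1) (by linarith) M p
  obtain ⟨C₂, hC₂, h₂⟩ := exists_sobNorm_dnonlin_le hs M p
  obtain ⟨C₃, hC₃, h₃⟩ := exists_sobNorm_dnonlin_le hs M (p - 1)
  obtain ⟨C₄, hC₄, h₄⟩ := exists_sobNorm_nonlin_le (r := s + 1) (by linarith) M (p - 1)
  have hc : ∀ r : ℝ, 0 ≤ wtConst * 2 ^ r := fun r => mul_nonneg wtConst_nonneg (two_rpow_nonneg r)
  set D := p * (wtConst * 2 ^ |s| * (C₃ * |M|) + wtConst * 2 ^ |s - 1| * (C₄ * (4 * |M| + C₁)))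
    with hD
  have hD0 : 0 ≤ D := by
    have := hc |s|
    have := hc |s - 1|
    positivity
  refine ⟨C₁ + C₂ + D, by positivity, fun K hK W y v hW hyv => ?_⟩
  have hy : sobNorm (s + 1) y ≤ M := by linarith [sobNorm_nonneg s v]
  have hv : sobNorm s v ≤ M := by linarith [sobNorm_nonneg (s + 1) y]
  have hM : M ≤ |M| := le_abs_self M
  have b₁ := h₁ K hK y hy
  have b₂ := h₂ K hK y v hy hv
  refine ⟨by linarith, by linarith, ?_⟩
  set a : Coeff K := fun j => -((W j : ℂ) ^ 2 * y j) + nonlin p y j with ha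
  -- The squared frequencies cost two derivatives, so the acceleration is only in `H^(s-1)`.
  have ba : sobNorm (s - 1) a ≤ 4 * |M| + C₁ := by
    have e : a = nonlin p y - diag (fun j => W j ^ 2) y := by
      funext j
      simp only [ha, diag, Pi.sub_apply, Complex.ofReal_pow]
      ring
    have h5 : sobNorm (s - 1) (diag (fun j => W j ^ 2) y) ≤ 4 * sobNorm (s - 1 + 2) y := by
      refine sobNorm_diag_le (by norm_num) (fun j => ?_) y
      rw [abs_pow, Real.rpow_two]
      nlinarith [hW j, abs_nonneg (W j), wt_pos j]
    rw [show s - 1 + 2 = s + 1 by ring] at h5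
    rw [e]
    refine (sobNorm_sub_le _ _ _).trans ?_
    have h6 := sobNorm_mono (show s - 1 ≤ s + 1 by linarith) (nonlin p y)
    linarith
  refine le_trans ?_ (show D ≤ C₁ + C₂ + D by linarith)
  rw [ddnonlin, sobNorm_smul, abs_of_nonneg (Nat.cast_nonneg p), hD]
  refine mul_le_mul_of_nonneg_left ((sobNorm_add_le _ _ _).trans (add_le_add ?_ ?_))
    (Nat.cast_nonneg p)
  · refine (sobNorm_mono (show s - 2 ≤ s - 1 by linarith) _).trans
      ((sobNorm_conv_le_sub_one hK s _ _).trans (mul_le_mul_of_nonneg_left ?_ (hc _)))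
    rw [abs_of_nonneg hs]
    exact mul_le_mul (h₃ K hK y v hy hv) (hv.trans hM) (sobNorm_nonneg _ _) hC₃
  -- The product with the acceleration loses one more derivative. This term, the roughest one,
  -- dictates the exponent `s - 2`.
  · rw [show s - 2 = s - 1 - 1 by ring]
    refine (sobNorm_conv_le_sub_one hK (s - 1) _ _).trans
      (mul_le_mul_of_nonneg_left ?_ (hc _))
    have h7 : |s - 1| ≤ s + 1 := abs_le.2 ⟨by linarith, by linarith⟩
    exact mul_le_mul ((sobNorm_mono h7 _).trans (h₄ K hK y hy)) ba (sobNorm_nonneg _ _) hC₄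

end SemiWave

end

/-! ### Quadrature defects of exact solutions in the variation-of-constants formula. -/

noncomputable section

namespace SemiWave

open Finset hiding Icc
open Set

variable {K : ℕ}

/-- The half weight at `m = 0` matches the factor `1/2` in the leapfrog starting step. The one at `m
= n` multiplies a sine kernel that vanishes there for positions, and a cosine kernel equal to 1 for
velocities. -/
theorem trap_eq_sum {E : Type*} [AddCommGroup E] [Module ℝ E] (n : ℕ) (G : ℕ → E) :
    trap n G = ∑ m ∈ range n, (if m = 0 then (1 / 2 : ℝ) else 1) • G m
      + (if n = 0 then (0 : ℝ) else 1 / 2) • G n := by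
  induction n with
  | zero => simp [trap]
  | succ n ih =>
    rw [trap, sum_range_succ, ← trap, ih, sum_range_succ]
    rcases n with _ | n
    · simp
    · simp only [Nat.succ_ne_zero, if_false]
      module

theorem trap_sub {E : Type*} [AddCommGroup E] [Module ℝ E] (n : ℕ) (G H : ℕ → E) :
    trap n G - trap n H = trap n fun m => G m - H m := by
  rw [trap, trap, trap, ← sum_sub_distrib]
  exact sum_congr rfl fun m _ => by module

theorem sobNorm_trap_le (σ : ℝ) (n : ℕ) (G : ℕ → Coeff K) :
    sobNorm σ (trap n G) ≤ ∑ m ∈ range (n + 1), sobNorm σ (G m) := by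
  rw [trap_eq_sum, sum_range_succ]
  refine (sobNorm_add_le _ _ _).trans (add_le_add ((sobNorm_sum_le _ _ _).trans
    (sum_le_sum fun m _ => ?_)) ?_)
  · rw [sobNorm_smul]
    refine mul_le_of_le_one_left (sobNorm_nonneg _ _) ?_
    split_ifs <;> norm_num [abs_of_pos]
  · rw [sobNorm_smul]
    refine mul_le_of_le_one_left (sobNorm_nonneg _ _) ?_
    split_ifs <;> norm_num [abs_of_pos]

theorem diag_one (y : Coeff K) : diag (fun _ => 1) y = y := by
  funext j; simp [diag]

theorem diag_zero (y : Coeff K) : diag (fun _ => 0) y = 0 := by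
  funext j; simp [diag]

/-- `sin (w x) / w`, continued by `x` to `w = 0`. -/
def sinK (w x : ℝ) : ℝ := if w = 0 then x else Real.sin (w * x) / w

theorem hasDerivAt_sinK (w x : ℝ) : HasDerivAt (sinK w) (Real.cos (w * x)) x := by
  by_cases hw : w = 0
  · have : sinK w = id := by funext x; simp [sinK, hw]
    rw [this, hw]
    simpa using hasDerivAt_id x
  · have : sinK w = fun x => Real.sin (w * x) / w := by funext x; simp [sinK, hw]
    rw [this]
    refine ((((hasDerivAt_id x).const_mul w).sin).div_const w).congr_deriv ?_
    simp [hw]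

/-- Frequencies that are comparable with the weights away from the zero mode. -/
def FreqLike (W : Modes K → ℝ) : Prop :=
  ∀ j, (W j = 0 ∧ freq j = 0) ∨ (wt j ≤ W j ∧ W j ≤ 2 * wt j)

theorem FreqLike.nonneg {W : Modes K → ℝ} (hW : FreqLike W) (j : Modes K) : 0 ≤ W j := by
  rcases hW j with h | h
  · exact h.1.ge
  · exact (wt_pos j).le.trans h.1

theorem FreqLike.le {W : Modes K → ℝ} (hW : FreqLike W) (j : Modes K) : W j ≤ 2 * wt j := by
  rcases hW j with h | h
  · rw [h.1]; linarith [wt_pos j]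
  · exact h.2

theorem FreqLike.abs_le {W : Modes K → ℝ} (hW : FreqLike W) (j : Modes K) :
    |W j| ≤ 2 * wt j := by
  rw [abs_of_nonneg (hW.nonneg j)]
  exact hW.le j

theorem freqLike_freq : FreqLike (freq : Modes K → ℝ) := fun j => by
  rcases freq_eq_zero_or j with h | h
  · exact Or.inl ⟨h, h⟩
  · exact Or.inr ⟨h.2.le, by linarith [h.2, wt_pos j]⟩

/-- The kernel gains a derivative away from the zero mode; on the zero mode it grows linearly,
whence the dependence on `T`. -/
theorem FreqLike.abs_sinK_le {W : Modes K → ℝ} (hW : FreqLike W) {T x : ℝ} (hx : |x| ≤ T)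
    (j : Modes K) : |sinK (W j) x| ≤ (1 + T) * wt j ^ (-1 : ℝ) := by
  have hT : 0 ≤ T := (abs_nonneg x).trans hx
  rw [Real.rpow_neg_one]
  rcases hW j with h | h
  · rw [sinK, if_pos h.1, wt_eq_one h.2]
    linarith
  · have hw : 0 < W j := (wt_pos j).trans_le h.1
    rw [sinK, if_neg hw.ne', abs_div, abs_of_pos hw, div_eq_mul_inv]
    refine mul_le_mul ((Real.abs_sin_le_one _).trans (by linarith)) ?_ (by positivity)
      (by positivity)
    exact inv_anti₀ (wt_pos j) h.1

/-- The defect of the position in the discretized variation-of-constants formula. -/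
def posDefect (p : ℕ) (W : Modes K → ℝ) (t₀ h : ℝ) (y v : ℝ → Coeff K) (n : ℕ) : Coeff K :=
  y (t₀ + n * h) - (diag (fun j => Real.cos (W j * (n * h))) (y t₀) +
      diag (fun j => sinK (W j) (n * h)) (v t₀)) -
    h • trap n fun m => diag (fun j => sinK (W j) (n * h - m * h)) (nonlin p (y (t₀ + m * h)))

/-- The defect of the velocity in the discretized variation-of-constants formula. -/
def velDefect (p : ℕ) (W : Modes K → ℝ) (t₀ h : ℝ) (y v : ℝ → Coeff K) (n : ℕ) : Coeff K :=
  v (t₀ + n * h) - (diag (fun j => -(W j * Real.sin (W j * (n * h)))) (y t₀) +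
      diag (fun j => Real.cos (W j * (n * h))) (v t₀)) -
    h • trap n fun m =>
      diag (fun j => Real.cos (W j * (n * h - m * h))) (nonlin p (y (t₀ + m * h)))

theorem hasDerivAt_const_sub_comp {f : ℝ → ℝ} {f' τ t : ℝ} (hf : HasDerivAt f f' (τ - t)) :
    HasDerivAt (fun t => f (τ - t)) (-f') t := by
  refine (hf.comp t ((hasDerivAt_id t).const_sub τ)).congr_deriv ?_
  simp

theorem hasDerivAt_cos_mul (w x : ℝ) :
    HasDerivAt (fun x => Real.cos (w * x)) (-(w * Real.sin (w * x))) x := by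
  refine (((hasDerivAt_id x).const_mul w).cos).congr_deriv ?_
  simp; ring

theorem hasDerivAt_mul_sin_mul (w x : ℝ) :
    HasDerivAt (fun x => w * Real.sin (w * x)) (w ^ 2 * Real.cos (w * x)) x := by
  refine ((((hasDerivAt_id x).const_mul w).sin).const_mul w).congr_deriv ?_
  simp; ring

section Solution

variable {p : ℕ} {W : Modes K → ℝ} {t₀ T : ℝ} {y v : ℝ → Coeff K}

theorem mul_sinK (w x : ℝ) : w * sinK w x = Real.sin (w * x) := by
  unfold sinK
  split_ifs with h
  · simp [h]
  · field_simp

/-- Interaction picture: transporting the state at time `t` to time `τ` by the free flow cancels the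
linear terms. The curve runs from the free evolution of the data to the position at `τ`, so applying
the trapezoidal rule to it gives `posDefect` without forming an integral. -/
theorem IsSolution.hasDerivWithinAt_pos (hy : IsSolution p W t₀ T y v) (τ : ℝ) {t : ℝ}
    (ht : t ∈ Icc t₀ (t₀ + T)) :
    HasDerivWithinAt (fun t => diag (fun j => Real.cos (W j * (τ - t))) (y t) +
        diag (fun j => sinK (W j) (τ - t)) (v t))
      (diag (fun j => sinK (W j) (τ - t)) (nonlin p (y t))) (Icc t₀ (t₀ + T)) t := by
  obtain ⟨h1, h2⟩ := hy t ht
  refine ((hasDerivWithinAt_diag (k' := fun j t => W j * Real.sin (W j * (τ - t)))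
    (fun j => (hasDerivAt_const_sub_comp (hasDerivAt_cos_mul (W j) (τ - t))).congr_deriv
      (neg_neg _)) h1).fun_add
    (hasDerivWithinAt_diag (k' := fun j t => -Real.cos (W j * (τ - t)))
      (fun j => hasDerivAt_const_sub_comp (hasDerivAt_sinK (W j) (τ - t))) h2)).congr_deriv ?_
  funext j
  have := mul_sinK (W j) (τ - t)
  have h3 : (W j : ℂ) * (sinK (W j) (τ - t) : ℂ) = (Real.sin (W j * (τ - t)) : ℂ) := by
    rw [← this]; push_cast; ring
  simp only [diag, Pi.add_apply, Complex.ofReal_neg, Complex.ofReal_mul, ← h3]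
  ring

theorem IsSolution.hasDerivWithinAt_vel (hy : IsSolution p W t₀ T y v) (τ : ℝ) {t : ℝ}
    (ht : t ∈ Icc t₀ (t₀ + T)) :
    HasDerivWithinAt (fun t => diag (fun j => -(W j * Real.sin (W j * (τ - t)))) (y t) +
        diag (fun j => Real.cos (W j * (τ - t))) (v t))
      (diag (fun j => Real.cos (W j * (τ - t))) (nonlin p (y t))) (Icc t₀ (t₀ + T)) t := by
  obtain ⟨h1, h2⟩ := hy t ht
  refine ((hasDerivWithinAt_diag (k' := fun j t => W j ^ 2 * Real.cos (W j * (τ - t)))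
    (fun j => (hasDerivAt_const_sub_comp (hasDerivAt_mul_sin_mul (W j) (τ - t))).fun_neg.congr_deriv
      (neg_neg _)) h1).fun_add
    (hasDerivWithinAt_diag (k' := fun j t => W j * Real.sin (W j * (τ - t)))
      (fun j => (hasDerivAt_const_sub_comp (hasDerivAt_cos_mul (W j) (τ - t))).congr_deriv
        (neg_neg _)) h2)).congr_deriv ?_
  funext j
  simp only [diag, Pi.add_apply, Complex.ofReal_neg, Complex.ofReal_mul,
    Complex.ofReal_pow]
  ring

/-- The position kernel has order `-1` and the velocity kernel order `0`, hence `a = 0` and `a = 1`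
with `σ = s + 1`. The constant `4 + T` is chosen to dominate all kernel bounds, including those in
the second-order version. -/
theorem sobNorm_defect_le {s B h : ℝ} (hK : 1 ≤ K) (hW : FreqLike W) (hh : 0 ≤ h) (hT : 0 ≤ T)
    (hy : IsSolution p W t₀ T y v)
    (b₀ : ∀ t ∈ Icc t₀ (t₀ + T), sobNorm (s + 1) (nonlin p (y t)) ≤ B)
    (b₁ : ∀ t ∈ Icc t₀ (t₀ + T), sobNorm s (dnonlin p (y t) (v t)) ≤ B)
    (n : ℕ) (hn : (n : ℝ) * h ≤ T) :
    sobNorm (s + 1) (posDefect p W t₀ h y v n) ≤ 2 * (4 + T) * B * T * h ∧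
    sobNorm s (velDefect p W t₀ h y v n) ≤ 2 * (4 + T) * B * T * h := by
  have hA : 0 ≤ 4 + T := by linarith
  have hnT := node_mem_Icc (t₀ := t₀) hh hn
  have hx : ∀ t ∈ Icc t₀ (t₀ + T), |t₀ + n * h - t| ≤ T := fun t ht =>
    _root_.abs_le.2 ⟨by linarith [hnT.1, ht.2], by linarith [hnT.2, ht.1]⟩
  have hg : ∀ t ∈ Icc t₀ (t₀ + T), HasDerivWithinAt (fun t => nonlin p (y t))
      (dnonlin p (y t) (v t)) (Icc t₀ (t₀ + T)) t := fun t ht =>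
    hasDerivWithinAt_nonlin hK p (hy t ht).1
  have b₁' : ∀ t ∈ Icc t₀ (t₀ + T), sobNorm (s + 1 - 1) (dnonlin p (y t) (v t)) ≤ B := by
    rw [show s + 1 - 1 = s by ring]; exact b₁
  constructor
  · have key := sobNorm_kernel_trap_le (σ := s + 1) (a := 0) hh hT hA
      (fun t ht => hy.hasDerivWithinAt_pos (t₀ + n * h) ht) hg
      (fun j t => hasDerivAt_const_sub_comp (hasDerivAt_sinK (W j) (t₀ + n * h - t)))
      (fun t ht j => ?_) (fun t ht j => ?_) b₀ b₁' n hn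
    · simpa [posDefect, sinK, diag_one, diag_zero, add_sub_add_left_eq_sub] using key
    · refine (hW.abs_sinK_le (hx t ht) j).trans ?_
      rw [zero_sub]
      exact mul_le_mul_of_nonneg_right (by linarith) (wt_rpow_nonneg _ j)
    · rw [abs_neg, Real.rpow_zero]
      linarith [Real.abs_cos_le_one (W j * (t₀ + n * h - t))]
  · have key := sobNorm_kernel_trap_le (σ := s + 1) (a := 1) hh hT hA
      (fun t ht => hy.hasDerivWithinAt_vel (t₀ + n * h) ht) hg
      (fun j t => hasDerivAt_const_sub_comp (hasDerivAt_cos_mul (W j) (t₀ + n * h - t)))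
      (fun t ht j => ?_) (fun t ht j => ?_) b₀ b₁' n hn
    · simpa [velDefect, diag_one, diag_zero, add_sub_add_left_eq_sub] using key
    · rw [sub_self, Real.rpow_zero]
      linarith [Real.abs_cos_le_one (W j * (t₀ + n * h - t))]
    · rw [abs_neg, abs_neg, abs_mul, Real.rpow_one]
      nlinarith [Real.abs_sin_le_one (W j * (t₀ + n * h - t)), hW.abs_le j, wt_pos j,
        abs_nonneg (W j), abs_nonneg (Real.sin (W j * (t₀ + n * h - t)))]

/-- A second order in `h` needs two derivatives of the integrand. Since `ddnonlin` is controlled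
only in `H^(s-2)`, `σ` drops to `s - 1`. -/
theorem sobNorm_defect_le_sq {s B h : ℝ} (hK : 1 ≤ K) (hW : FreqLike W) (hh : 0 ≤ h) (hT : 0 ≤ T)
    (hy : IsSolution p W t₀ T y v)
    (b₀ : ∀ t ∈ Icc t₀ (t₀ + T), sobNorm (s + 1) (nonlin p (y t)) ≤ B)
    (b₁ : ∀ t ∈ Icc t₀ (t₀ + T), sobNorm s (dnonlin p (y t) (v t)) ≤ B)
    (b₂ : ∀ t ∈ Icc t₀ (t₀ + T), sobNorm (s - 2) (ddnonlin p (y t) (v t)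
      (fun j => -((W j : ℂ) ^ 2 * y t j) + nonlin p (y t) j)) ≤ B)
    (n : ℕ) (hn : (n : ℝ) * h ≤ T) :
    sobNorm (s - 1) (posDefect p W t₀ h y v n) ≤ 4 * (4 + T) * B * T * h ^ 2 ∧
    sobNorm (s - 2) (velDefect p W t₀ h y v n) ≤ 4 * (4 + T) * B * T * h ^ 2 := by
  have hA : 0 ≤ 4 + T := by linarith
  have hnT := node_mem_Icc (t₀ := t₀) hh hn
  have hx : ∀ t ∈ Icc t₀ (t₀ + T), |t₀ + n * h - t| ≤ T := fun t ht =>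
    _root_.abs_le.2 ⟨by linarith [hnT.1, ht.2], by linarith [hnT.2, ht.1]⟩
  have hg : ∀ t ∈ Icc t₀ (t₀ + T), HasDerivWithinAt (fun t => nonlin p (y t))
      (dnonlin p (y t) (v t)) (Icc t₀ (t₀ + T)) t := fun t ht =>
    hasDerivWithinAt_nonlin hK p (hy t ht).1
  have hg' : ∀ t ∈ Icc t₀ (t₀ + T), HasDerivWithinAt (fun t => dnonlin p (y t) (v t))
      (ddnonlin p (y t) (v t) (fun j => -((W j : ℂ) ^ 2 * y t j) + nonlin p (y t) j))
      (Icc t₀ (t₀ + T)) t := fun t ht =>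
    hasDerivWithinAt_dnonlin hK p (hy t ht).1 (hy t ht).2
  have b₀' : ∀ t ∈ Icc t₀ (t₀ + T), sobNorm (s - 1 + 1) (nonlin p (y t)) ≤ B := fun t ht =>
    (sobNorm_mono (by linarith) _).trans (b₀ t ht)
  have b₁' : ∀ t ∈ Icc t₀ (t₀ + T), sobNorm (s - 1) (dnonlin p (y t) (v t)) ≤ B := fun t ht =>
    (sobNorm_mono (by linarith) _).trans (b₁ t ht)
  have b₂' : ∀ t ∈ Icc t₀ (t₀ + T), sobNorm (s - 1 - 1) (ddnonlin p (y t) (v t)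
      (fun j => -((W j : ℂ) ^ 2 * y t j) + nonlin p (y t) j)) ≤ B := by
    rw [show s - 1 - 1 = s - 2 by ring]; exact b₂
  have hsin : ∀ j t, |W j * Real.sin (W j * (t₀ + n * h - t))| ≤ (4 + T) * wt j := by
    intro j t
    rw [abs_mul]
    nlinarith [Real.abs_sin_le_one (W j * (t₀ + n * h - t)), hW.abs_le j, wt_pos j,
        abs_nonneg (W j), abs_nonneg (Real.sin (W j * (t₀ + n * h - t)))]
  constructor
  · have key := sobNorm_kernel_trap_le_sq (σ := s - 1) (a := 0) hh hT hA
      (fun t ht => hy.hasDerivWithinAt_pos (t₀ + n * h) ht) hg hg'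
      (fun j t => hasDerivAt_const_sub_comp (hasDerivAt_sinK (W j) (t₀ + n * h - t)))
      (fun j t => (hasDerivAt_const_sub_comp
        (hasDerivAt_cos_mul (W j) (t₀ + n * h - t))).fun_neg)
      (fun t ht j => ?_) (fun t ht j => ?_) (fun t ht j => ?_) b₀' b₁' b₂' n hn
    · simpa [posDefect, sinK, diag_one, diag_zero, add_sub_add_left_eq_sub] using key
    · refine (hW.abs_sinK_le (hx t ht) j).trans ?_
      rw [zero_sub]
      exact mul_le_mul_of_nonneg_right (by linarith) (wt_rpow_nonneg _ j)
    · rw [abs_neg, Real.rpow_zero]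
      linarith [Real.abs_cos_le_one (W j * (t₀ + n * h - t))]
    · rw [abs_neg, abs_neg, abs_neg, zero_add, Real.rpow_one]
      exact hsin j t
  · have key := sobNorm_kernel_trap_le_sq (σ := s - 1) (a := 1) hh hT hA
      (fun t ht => hy.hasDerivWithinAt_vel (t₀ + n * h) ht) hg hg'
      (fun j t => hasDerivAt_const_sub_comp (hasDerivAt_cos_mul (W j) (t₀ + n * h - t)))
      (fun j t => (hasDerivAt_const_sub_comp
        (hasDerivAt_mul_sin_mul (W j) (t₀ + n * h - t)).fun_neg).fun_neg)
      (fun t ht j => ?_) (fun t ht j => ?_) (fun t ht j => ?_) b₀' b₁' b₂' n hn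
    · rw [show s - 1 - 1 = s - 2 by ring] at key
      simpa [velDefect, diag_one, diag_zero, add_sub_add_left_eq_sub] using key
    · rw [sub_self, Real.rpow_zero]
      linarith [Real.abs_cos_le_one (W j * (t₀ + n * h - t))]
    · rw [abs_neg, abs_neg, Real.rpow_one]
      exact hsin j t
    · rw [show (1 : ℝ) + 1 = 2 by norm_num, Real.rpow_two]
      simp only [abs_neg, abs_mul, abs_pow]
      have h1 := Real.abs_cos_le_one (W j * (t₀ + n * h - t))
      have h2 : |W j| ^ 2 ≤ 4 * wt j ^ 2 := by
        nlinarith [hW.abs_le j, wt_pos j, abs_nonneg (W j)]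
      have h3 : |W j| ^ 2 * |Real.cos (W j * (t₀ + n * h - t))| ≤ |W j| ^ 2 :=
        mul_le_of_le_one_right (sq_nonneg _) h1
      nlinarith [mul_nonneg hT (sq_nonneg (wt j))]

end Solution

end SemiWave

end

/-! ### Phases and propagators of leapfrog, and its exact discrete variation-of-constants formula.
-/

noncomputable section

namespace SemiWave

open Finset hiding Icc
open Set

variable {K : ℕ}

/-- The phase `h ω̃_j` of one leapfrog step. -/
def phase (h : ℝ) (j : Modes K) : ℝ := Real.arccos (1 - h ^ 2 * freq j ^ 2 / 2)

/-- The ratio `sin (h ω̃_j) / (h ω_j)`. -/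
def damp (h : ℝ) (j : Modes K) : ℝ := Real.sqrt (1 - (h * freq j / 2) ^ 2)

/-- The propagator of the leapfrog positions acting on the initial positions. -/
def lfCos (h : ℝ) (j : Modes K) (n : ℕ) : ℝ := Real.cos (n * phase h j)

/-- The propagator of the leapfrog positions acting on the initial velocities. -/
def lfSin (h : ℝ) (j : Modes K) (n : ℕ) : ℝ :=
  if freq j = 0 then n * h else Real.sin (n * phase h j) / (freq j * damp h j)

/-- The propagator of the leapfrog velocities acting on the initial positions. -/
def lfVel (h : ℝ) (j : Modes K) (n : ℕ) : ℝ := -(freq j * (damp h j * Real.sin (n * phase h j)))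

/-- The lower bound of `damp` under the step-size restriction `h ω_j ≤ c < 2`. -/
def dampMin (c : ℝ) : ℝ := Real.sqrt (1 - (c / 2) ^ 2)

section Phase

variable {h c : ℝ} {j : Modes K}

theorem dampMin_pos (hc₀ : 0 ≤ c) (hc : c < 2) : 0 < dampMin c :=
  Real.sqrt_pos.2 (by nlinarith)

theorem dampMin_le (hh : 0 < h) (hj : h * freq j ≤ c) : dampMin c ≤ damp h j := by
  refine Real.sqrt_le_sqrt ?_
  have := mul_nonneg hh.le (freq_nonneg j)
  nlinarith

theorem damp_le_one : damp h j ≤ 1 :=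
  Real.sqrt_le_one.2 (by nlinarith [sq_nonneg (h * freq j / 2)])

theorem one_sub_damp_le : 1 - damp h j ≤ (h * freq j) ^ 2 := by
  have h0 : 0 ≤ damp h j := Real.sqrt_nonneg _
  have h1 : damp h j ≤ 1 := damp_le_one
  have h2 : 1 - (h * freq j / 2) ^ 2 ≤ damp h j ^ 2 := by
    rw [damp, Real.sq_sqrt']
    exact le_max_left _ _
  nlinarith [sq_nonneg (h * freq j)]

theorem cos_phase (hh : 0 < h) (hj : h * freq j ≤ c) (hc : c < 2) :
    Real.cos (phase h j) = 1 - h ^ 2 * freq j ^ 2 / 2 := by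
  have h0 := mul_nonneg hh.le (freq_nonneg j)
  exact Real.cos_arccos (by nlinarith) (by nlinarith)

theorem sin_phase (hh : 0 < h) : Real.sin (phase h j) = h * freq j * damp h j := by
  have h0 := mul_nonneg hh.le (freq_nonneg j)
  rw [phase, Real.sin_arccos, damp, ← Real.sqrt_sq h0, ← Real.sqrt_mul (sq_nonneg _),
    Real.sqrt_sq h0]
  congr 1
  ring

/-- The half-angle form of the cosine identity defining the phase; the sign is fixed by `phase`
lying in `[0, π]`. The comparisons of `phase` with `h * freq j` all follow from it. -/
theorem sin_half_phase (hh : 0 < h) (hj : h * freq j ≤ c) (hc : c < 2) :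
    Real.sin (phase h j / 2) = h * freq j / 2 := by
  have h0 := mul_nonneg hh.le (freq_nonneg j)
  have h1 := cos_phase hh hj hc
  have h2 : Real.cos (phase h j) = 1 - 2 * Real.sin (phase h j / 2) ^ 2 := by
    have h3 := Real.cos_two_mul (phase h j / 2)
    have h4 := Real.sin_sq_add_cos_sq (phase h j / 2)
    rw [mul_div_cancel₀ _ two_ne_zero] at h3
    linarith
  have h5 : 0 ≤ Real.sin (phase h j / 2) := by
    have h6 : 0 ≤ phase h j := Real.arccos_nonneg _
    have h7 : phase h j ≤ Real.pi := Real.arccos_le_pi _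
    exact Real.sin_nonneg_of_nonneg_of_le_pi (by linarith) (by linarith)
  have h8 : Real.sin (phase h j / 2) ^ 2 = (h * freq j / 2) ^ 2 := by linarith
  exact (sq_eq_sq₀ h5 (by linarith)).1 h8

theorem phase_nonneg : 0 ≤ phase h j := Real.arccos_nonneg _

theorem le_phase (hh : 0 < h) (hj : h * freq j ≤ c) (hc : c < 2) : h * freq j ≤ phase h j := by
  have h1 := sin_half_phase hh hj hc
  have h2 := Real.sin_le (div_nonneg (phase_nonneg (h := h) (j := j)) two_pos.le)
  linarith

/-- Jordan's inequality at the half phase, together with `π ≤ 4`. -/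
theorem phase_le (hh : 0 < h) (hj : h * freq j ≤ c) (hc : c < 2) :
    phase h j ≤ 2 * (h * freq j) := by
  have h1 := sin_half_phase hh hj hc
  have h0 := phase_nonneg (h := h) (j := j)
  have h7 : phase h j ≤ Real.pi := Real.arccos_le_pi _
  have h2 := Real.mul_le_sin (div_nonneg h0 two_pos.le) (by linarith : phase h j / 2 ≤ _)
  rw [h1] at h2
  have hpi : Real.pi ≤ 4 := Real.pi_le_four
  have h3 : phase h j ≤ Real.pi * (h * freq j / 2) := by
    have := mul_le_mul_of_nonneg_left h2 Real.pi_pos.le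
    have e : Real.pi * (2 / Real.pi * (phase h j / 2)) = phase h j := by
      field_simp
    linarith
  nlinarith [mul_nonneg hh.le (freq_nonneg j)]

/-- The cubic lower bound of the sine at the half phase: the per-step dispersion error, of third
order in `h`. -/
theorem phase_sub_le (hh : 0 < h) (hj : h * freq j ≤ c) (hc : c < 2) :
    phase h j - h * freq j ≤ (h * freq j) ^ 3 := by
  have h1 := sin_half_phase hh hj hc
  have h0 := phase_nonneg (h := h) (j := j)
  have h2 := Real.sin_ge_sub_cube (div_nonneg h0 two_pos.le)
  have h3 : (phase h j / 2) ^ 3 ≤ (h * freq j) ^ 3 :=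
    pow_le_pow_left₀ (by linarith) (by linarith [phase_le hh hj hc]) 3
  have h4 : 0 ≤ (h * freq j) ^ 3 := pow_nonneg (mul_nonneg hh.le (freq_nonneg j)) 3
  linarith

theorem modFreq_eq : modFreq h j = phase h j / h := rfl

theorem mul_modFreq (hh : 0 < h) (x : ℝ) : modFreq h j * (x * h) = x * phase h j := by
  rw [modFreq_eq]
  field_simp

theorem phase_eq_zero (hj : freq j = 0) : phase h j = 0 := by
  simp [phase, hj]

end Phase

theorem freqLike_modFreq {h c : ℝ} (hh : 0 < h) (hc : c < 2)
    (hj : ∀ j : Modes K, h * freq j ≤ c) : FreqLike (modFreq h : Modes K → ℝ) := fun j => by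
  rcases freq_eq_zero_or j with h0 | h0
  · exact Or.inl ⟨by rw [modFreq_eq, phase_eq_zero h0, zero_div], h0⟩
  · right
    rw [modFreq_eq, le_div_iff₀ hh, div_le_iff₀ hh, h0.2]
    exact ⟨by linarith [le_phase hh (hj j) hc], by linarith [phase_le hh (hj j) hc]⟩

section Recurrence

variable {h c : ℝ} {j : Modes K}

theorem lfCos_zero : lfCos h j 0 = 1 := by simp [lfCos]

theorem lfCos_one (hh : 0 < h) (hj : h * freq j ≤ c) (hc : c < 2) :
    lfCos h j 1 = 1 - h ^ 2 * freq j ^ 2 / 2 := by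
  rw [lfCos, Nat.cast_one, one_mul, cos_phase hh hj hc]

theorem lfCos_add_two (n : ℕ) :
    lfCos h j (n + 2) = 2 * lfCos h j 1 * lfCos h j (n + 1) - lfCos h j n := by
  have h1 := Real.cos_add ((n + 1) * phase h j) (phase h j)
  have h2 := Real.cos_sub ((n + 1) * phase h j) (phase h j)
  unfold lfCos
  push_cast
  rw [one_mul, show ((n : ℝ) + 2) * phase h j = (n + 1) * phase h j + phase h j by ring,
    show (n : ℝ) * phase h j = (n + 1) * phase h j - phase h j by ring, h1, h2]
  ring

theorem lfSin_zero : lfSin h j 0 = 0 := by simp [lfSin]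

theorem lfSin_one (hh : 0 < h) (hj : h * freq j ≤ c) (hc₀ : 0 ≤ c) (hc : c < 2) :
    lfSin h j 1 = h := by
  unfold lfSin
  split_ifs with h0
  · simp
  · have h1 := ((dampMin_pos hc₀ hc).trans_le (dampMin_le hh hj)).ne'
    rw [Nat.cast_one, one_mul, sin_phase hh]
    field_simp

theorem lfSin_add_two (n : ℕ) :
    lfSin h j (n + 2) = 2 * lfCos h j 1 * lfSin h j (n + 1) - lfSin h j n := by
  unfold lfSin lfCos
  split_ifs with h0
  · rw [phase_eq_zero h0]
    push_cast
    simp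
    ring
  · have h1 := Real.sin_add ((n + 1) * phase h j) (phase h j)
    have h2 := Real.sin_sub ((n + 1) * phase h j) (phase h j)
    push_cast
    rw [one_mul, show ((n : ℝ) + 2) * phase h j = (n + 1) * phase h j + phase h j by ring,
      show (n : ℝ) * phase h j = (n + 1) * phase h j - phase h j by ring, h1, h2]
    ring

/-- The factor `damp` in the denominator of `lfSin` cancels against `sin_phase`, so the centred
difference defining the velocities produces a pure cosine. -/
theorem lfSin_add_two_sub (hh : 0 < h) (hj : h * freq j ≤ c) (hc₀ : 0 ≤ c) (hc : c < 2) (n : ℕ) :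
    lfSin h j (n + 2) - lfSin h j n = 2 * h * lfCos h j (n + 1) := by
  unfold lfSin lfCos
  split_ifs with h0
  · rw [phase_eq_zero h0]
    push_cast
    simp
    ring
  · have h1 := Real.sin_add ((n + 1) * phase h j) (phase h j)
    have h2 := Real.sin_sub ((n + 1) * phase h j) (phase h j)
    have h3 := ((dampMin_pos hc₀ hc).trans_le (dampMin_le hh hj)).ne'
    push_cast
    rw [show ((n : ℝ) + 2) * phase h j = (n + 1) * phase h j + phase h j by ring,
      show (n : ℝ) * phase h j = (n + 1) * phase h j - phase h j by ring, h1, h2, sin_phase hh]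
    field_simp
    ring

theorem lfCos_add_two_sub (hh : 0 < h) (n : ℕ) :
    lfCos h j (n + 2) - lfCos h j n = 2 * h * lfVel h j (n + 1) := by
  have h1 := Real.cos_add ((n + 1) * phase h j) (phase h j)
  have h2 := Real.cos_sub ((n + 1) * phase h j) (phase h j)
  unfold lfCos lfVel
  push_cast
  rw [show ((n : ℝ) + 2) * phase h j = (n + 1) * phase h j + phase h j by ring,
    show (n : ℝ) * phase h j = (n + 1) * phase h j - phase h j by ring, h1, h2, sin_phase hh]
  ring

/-- Solution of an inhomogeneous three-term recurrence by its fundamental solution. -/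
theorem threeTerm_solution {x f : ℕ → ℂ} {v₀ : ℂ} {h : ℝ} {C S : ℕ → ℝ}
    (hC₀ : C 0 = 1) (hC : ∀ n, C (n + 2) = 2 * C 1 * C (n + 1) - C n)
    (hS₀ : S 0 = 0) (hS₁ : S 1 = h) (hS : ∀ n, S (n + 2) = 2 * C 1 * S (n + 1) - S n)
    (hx₁ : x 1 = C 1 * x 0 + h * v₀ + (1 / 2 : ℝ) * h ^ 2 * f 0)
    (hx : ∀ n, x (n + 2) = 2 * C 1 * x (n + 1) - x n + h ^ 2 * f (n + 1)) (n : ℕ) :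
    x n = C n * x 0 + S n * v₀ +
      h * ∑ m ∈ range n, (if m = 0 then (1 / 2 : ℝ) else 1) • ((S (n - m) : ℂ) * f m) := by
  induction n using Nat.twoStepInduction with
  | zero => simp [hC₀, hS₀]
  | one => rw [hx₁, hS₁]; simp [hS₁]; ring
  | more n ih₀ ih₁ =>
    have e₂ : ∑ m ∈ range (n + 1), (if m = 0 then (1 / 2 : ℝ) else 1) • ((S (n + 2 - m) : ℂ) * f m)
        = 2 * C 1 * ∑ m ∈ range (n + 1),
            (if m = 0 then (1 / 2 : ℝ) else 1) • ((S (n + 1 - m) : ℂ) * f m)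
          - ∑ m ∈ range (n + 1),
            (if m = 0 then (1 / 2 : ℝ) else 1) • ((S (n - m) : ℂ) * f m) := by
      rw [mul_sum, ← sum_sub_distrib]
      refine sum_congr rfl fun m hm => ?_
      have hm' : m ≤ n := by have := mem_range.1 hm; omega
      rw [show n + 2 - m = n - m + 2 by omega, show n + 1 - m = n - m + 1 by omega, hS]
      simp only [Complex.real_smul]
      push_cast
      ring
    -- Because `S 0 = 0`, a term may be added for free, and all three sums share one range.
    have e₀ : ∑ m ∈ range (n + 1), (if m = 0 then (1 / 2 : ℝ) else 1) • ((S (n - m) : ℂ) * f m)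
        = ∑ m ∈ range n, (if m = 0 then (1 / 2 : ℝ) else 1) • ((S (n - m) : ℂ) * f m) := by
      rw [sum_range_succ]; simp [hS₀]
    rw [hx, ih₁, ih₀, sum_range_succ _ (n + 1), e₂, e₀, hC, hS]
    rw [show n + 1 + 1 - (n + 1) = 1 by omega, hS₁]
    simp only [Nat.succ_ne_zero, if_false, Complex.real_smul]
    push_cast
    ring

end Recurrence

section Leapfrog

variable {h c : ℝ}

theorem leapfrog_apply_eq_sum (p : ℕ) (hh : 0 < h) (hc₀ : 0 ≤ c) (hc : c < 2)
    (y₀ v₀ : Coeff K) (j : Modes K) (hj : h * freq j ≤ c) (n : ℕ) :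
    leapfrog p h y₀ v₀ n j = lfCos h j n * y₀ j + lfSin h j n * v₀ j +
      h * ∑ m ∈ range n, (if m = 0 then (1 / 2 : ℝ) else 1) •
        ((lfSin h j (n - m) : ℂ) * nonlin p (leapfrog p h y₀ v₀ m) j) := by
  refine threeTerm_solution (x := fun n => leapfrog p h y₀ v₀ n j)
    (f := fun n => nonlin p (leapfrog p h y₀ v₀ n) j) lfCos_zero lfCos_add_two lfSin_zero
    (lfSin_one hh hj hc₀ hc) lfSin_add_two ?_ (fun n => ?_) n
  · rw [lfCos_one hh hj hc]
    simp only [leapfrog]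
    push_cast
    ring
  · rw [lfCos_one hh hj hc]
    simp only [leapfrog]
    push_cast
    ring

theorem trap_apply (n : ℕ) (G : ℕ → Coeff K) (j : Modes K) :
    trap n G j = trap n fun m => G m j := by
  simp [trap]

/-- The discrete variation-of-constants formula for the leapfrog positions. -/
theorem leapfrog_eq (p : ℕ) (hh : 0 < h) (hc₀ : 0 ≤ c) (hc : c < 2)
    (hj : ∀ j : Modes K, h * freq j ≤ c) (y₀ v₀ : Coeff K) (n : ℕ) :
    leapfrog p h y₀ v₀ n = diag (fun j => lfCos h j n) y₀ + diag (fun j => lfSin h j n) v₀ +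
      h • trap n fun m => diag (fun j => lfSin h j (n - m)) (nonlin p (leapfrog p h y₀ v₀ m)) := by
  funext j
  rw [leapfrog_apply_eq_sum p hh hc₀ hc y₀ v₀ j (hj j)]
  simp only [Pi.add_apply, Pi.smul_apply, trap_apply]
  simp only [trap_eq_sum, diag, Nat.sub_self, lfSin_zero,
    Complex.ofReal_zero, zero_mul, smul_zero, add_zero, Complex.real_smul]

/-- The discrete variation-of-constants formula for the leapfrog velocities. -/
theorem leapfrogVel_eq (p : ℕ) (hh : 0 < h) (hc₀ : 0 ≤ c) (hc : c < 2)
    (hj : ∀ j : Modes K, h * freq j ≤ c) (y₀ v₀ : Coeff K) (n : ℕ) :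
    leapfrogVel p h y₀ v₀ n = diag (fun j => lfVel h j n) y₀ + diag (fun j => lfCos h j n) v₀ +
      h • trap n fun m => diag (fun j => lfCos h j (n - m)) (nonlin p (leapfrog p h y₀ v₀ m)) := by
  funext j
  rcases n with _ | n
  · simp [leapfrogVel, trap, diag, lfVel, lfCos]
  · have hh' : (h : ℂ) ≠ 0 := Complex.ofReal_ne_zero.2 hh.ne'
    have e : ∑ m ∈ range (n + 1), (if m = 0 then (1 / 2 : ℝ) else 1) •
          ((lfSin h j (n + 2 - m) : ℂ) * nonlin p (leapfrog p h y₀ v₀ m) j)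
        = 2 * h * (∑ m ∈ range (n + 1), (if m = 0 then (1 / 2 : ℝ) else 1) •
            ((lfCos h j (n + 1 - m) : ℂ) * nonlin p (leapfrog p h y₀ v₀ m) j))
          + ∑ m ∈ range n, (if m = 0 then (1 / 2 : ℝ) else 1) •
            ((lfSin h j (n - m) : ℂ) * nonlin p (leapfrog p h y₀ v₀ m) j) := by
      have e₀ : ∑ m ∈ range n, (if m = 0 then (1 / 2 : ℝ) else 1) •
            ((lfSin h j (n - m) : ℂ) * nonlin p (leapfrog p h y₀ v₀ m) j)
          = ∑ m ∈ range (n + 1), (if m = 0 then (1 / 2 : ℝ) else 1) •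
            ((lfSin h j (n - m) : ℂ) * nonlin p (leapfrog p h y₀ v₀ m) j) := by
        rw [sum_range_succ]; simp [lfSin_zero]
      rw [e₀, mul_sum, ← sum_add_distrib]
      refine sum_congr rfl fun m hm => ?_
      have hm' : m ≤ n := by have := mem_range.1 hm; omega
      have h1 := lfSin_add_two_sub hh (hj j) hc₀ hc (n - m)
      rw [show n + 2 - m = n - m + 2 by omega, show n + 1 - m = n - m + 1 by omega,
        show lfSin h j (n - m + 2) = 2 * h * lfCos h j (n - m + 1) + lfSin h j (n - m) by linarith]
      simp only [Complex.real_smul]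
      push_cast
      ring
    simp only [leapfrogVel, Pi.add_apply, Pi.smul_apply, trap_apply]
    simp only [trap_eq_sum, diag, Nat.sub_self, lfCos_zero]
    -- The last source term of the later position carries `lfSin` at 1, which is `h`; division by
    -- `2h` turns it into the end weight `1/2` of the trapezoidal sum.
    rw [div_eq_iff (mul_ne_zero two_ne_zero hh'),
      leapfrog_apply_eq_sum p hh hc₀ hc y₀ v₀ j (hj j),
      leapfrog_apply_eq_sum p hh hc₀ hc y₀ v₀ j (hj j), sum_range_succ _ (n + 1), e,
      show n + 2 - (n + 1) = 1 by omega, lfSin_one hh (hj j) hc₀ hc,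
      show lfSin h j (n + 2) = 2 * h * lfCos h j (n + 1) + lfSin h j n by
        linarith [lfSin_add_two_sub hh (hj j) hc₀ hc n],
      show lfCos h j (n + 2) = 2 * h * lfVel h j (n + 1) + lfCos h j n by
        linarith [lfCos_add_two_sub hh (j := j) n]]
    simp only [Nat.succ_ne_zero, if_false, Complex.real_smul]
    push_cast
    ring

end Leapfrog

end SemiWave

end

/-! ### Propagator errors, discrete Gronwall argument and interpolation. -/

noncomputable section

namespace SemiWave

open Finset hiding Icc
open Set

variable {K : ℕ}

section Kernel

variable {h c T : ℝ} {j : Modes K} {n : ℕ}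

/-- This is `min 1 x ≤ x ^ θ` for `0 ≤ θ ≤ 1`, with `x = h² X³` and `θ = β / 2`: the origin of the
`3/2` derivatives lost per order of `h`. -/
theorem min_one_le_rpow {β X : ℝ} (hh : 0 < h) (hX : 0 < X) (hβ : 0 ≤ β) (hβ₂ : β ≤ 2) :
    min 1 (h ^ 2 * X ^ 3) ≤ h ^ β * X ^ (3 * β / 2) := by
  have e : h ^ β * X ^ (3 * β / 2) = (h ^ 2 * X ^ 3) ^ (β / 2) := by
    rw [Real.mul_rpow (by positivity) (by positivity), ← Real.rpow_natCast, ← Real.rpow_natCast,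
      ← Real.rpow_mul hh.le, ← Real.rpow_mul hX.le]
    congr 2 <;> push_cast <;> ring
  rw [e]
  have h0 : 0 < h ^ 2 * X ^ 3 := by positivity
  rcases le_total 1 (h ^ 2 * X ^ 3) with h1 | h1
  · exact (min_le_left _ _).trans (Real.one_le_rpow h1 (by linarith))
  · refine (min_le_right _ _).trans ?_
    conv_lhs => rw [← Real.rpow_one (h ^ 2 * X ^ 3)]
    exact Real.rpow_le_rpow_of_exponent_ge h0 h1 (by linarith)

theorem one_sub_damp_le_min :
    1 - damp h j ≤ min 1 (h ^ 2 * wt j ^ 3) := by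
  refine le_min (by linarith [show 0 ≤ damp h j from Real.sqrt_nonneg _])
    (one_sub_damp_le.trans ?_)
  have h1 : freq j ^ 2 ≤ wt j ^ 2 := pow_le_pow_left₀ (freq_nonneg j) (freq_le_wt j) 2
  have h2 : wt j ^ 2 ≤ wt j ^ 3 := pow_le_pow_right₀ (one_le_wt j) (by norm_num)
  rw [mul_pow]
  exact mul_le_mul_of_nonneg_left (h1.trans h2) (sq_nonneg h)

/-- The dispersion errors of `n` steps add up, and `n h ≤ T` absorbs one power of `h`. -/
theorem abs_phase_sub_le (hh : 0 < h) (hj : h * freq j ≤ c) (hc : c < 2)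
    (hn : (n : ℝ) * h ≤ T) :
    |freq j * (n * h) - n * phase h j| ≤ T * (h ^ 2 * wt j ^ 3) := by
  have h1 := le_phase hh hj hc
  have h2 := phase_sub_le hh hj hc
  have h3 : freq j ^ 3 ≤ wt j ^ 3 := pow_le_pow_left₀ (freq_nonneg j) (freq_le_wt j) 3
  have hn0 : (0 : ℝ) ≤ n := Nat.cast_nonneg n
  rw [abs_sub_comm, abs_of_nonneg (by nlinarith)]
  calc n * phase h j - freq j * (n * h) = n * (phase h j - h * freq j) := by ring
    _ ≤ n * (h * freq j) ^ 3 := mul_le_mul_of_nonneg_left h2 hn0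
    _ = n * h * (h ^ 2 * freq j ^ 3) := by ring
    _ ≤ T * (h ^ 2 * wt j ^ 3) := by
        refine mul_le_mul hn (mul_le_mul_of_nonneg_left h3 (sq_nonneg h)) ?_
          ((mul_nonneg hn0 hh.le).trans hn)
        exact mul_nonneg (sq_nonneg h) (pow_nonneg (freq_nonneg j) 3)

theorem le_two_add_mul_min {d X : ℝ} (hT : 0 ≤ T) (hX : 0 ≤ X) (h₁ : d ≤ 2) (h₂ : d ≤ T * X) :
    d ≤ (2 + T) * min 1 X := by
  rcases le_total 1 X with h | h
  · rw [min_eq_left h]; linarith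
  · rw [min_eq_right h]; linarith

theorem abs_cos_sub_lfCos_le (hh : 0 < h) (hj : h * freq j ≤ c) (hc : c < 2)
    (hn : (n : ℝ) * h ≤ T) :
    |Real.cos (freq j * (n * h)) - lfCos h j n| ≤ (2 + T) * min 1 (h ^ 2 * wt j ^ 3) := by
  have hT : 0 ≤ T := le_trans (by positivity) hn
  refine le_two_add_mul_min hT (mul_nonneg (sq_nonneg h) (pow_nonneg (wt_pos j).le 3)) ?_
    ((Real.abs_cos_sub_cos_le _ _).trans (abs_phase_sub_le hh hj hc hn))
  refine (abs_sub _ _).trans ?_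
  have h1 := Real.abs_cos_le_one (freq j * (n * h))
  have h2 := Real.abs_cos_le_one (n * phase h j)
  unfold lfCos
  linarith

theorem abs_sin_sub_sin_phase_le (hh : 0 < h) (hj : h * freq j ≤ c) (hc : c < 2)
    (hn : (n : ℝ) * h ≤ T) :
    |Real.sin (freq j * (n * h)) - Real.sin (n * phase h j)|
      ≤ (2 + T) * min 1 (h ^ 2 * wt j ^ 3) := by
  have hT : 0 ≤ T := le_trans (by positivity) hn
  refine le_two_add_mul_min hT (mul_nonneg (sq_nonneg h) (pow_nonneg (wt_pos j).le 3)) ?_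
    ((Real.abs_sin_sub_sin_le _ _).trans (abs_phase_sub_le hh hj hc hn))
  refine (abs_sub _ _).trans ?_
  have h1 := Real.abs_sin_le_one (freq j * (n * h))
  have h2 := Real.abs_sin_le_one (n * phase h j)
  linarith

/-- The difference splits into a phase error and the amplitude error `1 - damp` divided by `damp`;
the step-size restriction bounds `damp` from below. Both retain the smoothing factor of the kernel.
-/
theorem abs_sinK_sub_lfSin_le (hh : 0 < h) (hj : h * freq j ≤ c) (hc₀ : 0 ≤ c) (hc : c < 2)
    (hn : (n : ℝ) * h ≤ T) :
    |sinK (freq j) (n * h) - lfSin h j n|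
      ≤ (2 + T + (dampMin c)⁻¹) * min 1 (h ^ 2 * wt j ^ 3) * (wt j)⁻¹ := by
  have hT : 0 ≤ T := le_trans (by positivity) hn
  have hδ := dampMin_pos hc₀ hc
  have hμ : 0 ≤ min 1 (h ^ 2 * wt j ^ 3) :=
    le_min zero_le_one (mul_nonneg (sq_nonneg h) (pow_nonneg (wt_pos j).le 3))
  rcases freq_eq_zero_or j with h0 | h0
  · rw [sinK, lfSin, if_pos h0, if_pos h0, sub_self, abs_zero]
    have := wt_pos j
    positivity
  · have hf : 0 < freq j := zero_lt_one.trans_le h0.1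
    have hρ := hδ.trans_le (dampMin_le hh hj)
    have h1 := abs_sin_sub_sin_phase_le hh hj hc hn
    have h2 := one_sub_damp_le_min (h := h) (j := j)
    have h3 : |Real.sin (n * phase h j) * ((1 - damp h j) * (damp h j)⁻¹)|
        ≤ (dampMin c)⁻¹ * min 1 (h ^ 2 * wt j ^ 3) := by
      have h4 : 0 ≤ 1 - damp h j := by linarith [damp_le_one (h := h) (j := j)]
      rw [abs_mul, abs_of_nonneg (mul_nonneg h4 (inv_nonneg.2 hρ.le))]
      refine (mul_le_of_le_one_left (mul_nonneg h4 (inv_nonneg.2 hρ.le))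
        (Real.abs_sin_le_one _)).trans ?_
      rw [mul_comm]
      exact mul_le_mul (inv_anti₀ hδ (dampMin_le hh hj)) h2 h4 (inv_nonneg.2 hδ.le)
    rw [sinK, lfSin, if_neg hf.ne', if_neg hf.ne', h0.2]
    have e : Real.sin (freq j * (n * h)) / freq j - Real.sin (n * phase h j) / (freq j * damp h j)
        = (Real.sin (freq j * (n * h)) - Real.sin (n * phase h j) -
          Real.sin (n * phase h j) * ((1 - damp h j) * (damp h j)⁻¹)) * (freq j)⁻¹ := by
      field_simp
      ring
    rw [e, abs_mul, abs_of_pos (inv_pos.2 hf)]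
    refine mul_le_mul_of_nonneg_right ?_ (inv_nonneg.2 hf.le)
    rw [h0.2] at h1 h3
    refine (abs_sub _ _).trans ?_
    linarith

theorem abs_mul_sin_sub_lfVel_le (hh : 0 < h) (hj : h * freq j ≤ c) (hc : c < 2)
    (hn : (n : ℝ) * h ≤ T) :
    |-(freq j * Real.sin (freq j * (n * h))) - lfVel h j n|
      ≤ (3 + T) * min 1 (h ^ 2 * wt j ^ 3) * wt j := by
  have h1 := abs_sin_sub_sin_phase_le hh hj hc hn
  have h2 := one_sub_damp_le_min (h := h) (j := j)
  have h4 : 0 ≤ 1 - damp h j := by linarith [damp_le_one (h := h) (j := j)]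
  have h3 : |Real.sin (n * phase h j) * (1 - damp h j)| ≤ min 1 (h ^ 2 * wt j ^ 3) := by
    rw [abs_mul, abs_of_nonneg h4]
    exact (mul_le_of_le_one_left h4 (Real.abs_sin_le_one _)).trans h2
  have e : -(freq j * Real.sin (freq j * (n * h))) - lfVel h j n
      = -((Real.sin (freq j * (n * h)) - Real.sin (n * phase h j) +
        Real.sin (n * phase h j) * (1 - damp h j)) * freq j) := by
    unfold lfVel
    ring
  rw [e, abs_neg, abs_mul, abs_of_nonneg (freq_nonneg j)]
  have h5 := (abs_add_le (Real.sin (freq j * (n * h)) - Real.sin (n * phase h j))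
    (Real.sin (n * phase h j) * (1 - damp h j))).trans
    (show _ ≤ (3 + T) * min 1 (h ^ 2 * wt j ^ 3) by linarith)
  exact mul_le_mul h5 (freq_le_wt j) (freq_nonneg j) ((abs_nonneg _).trans h5)

theorem abs_lfCos_le : |lfCos h j n| ≤ 1 := Real.abs_cos_le_one _

theorem abs_lfSin_le (hh : 0 < h) (hj : h * freq j ≤ c) (hc₀ : 0 ≤ c) (hc : c < 2)
    (hn : (n : ℝ) * h ≤ T) : |lfSin h j n| ≤ (2 + T + (dampMin c)⁻¹) * (wt j)⁻¹ := by
  have hT : 0 ≤ T := le_trans (by positivity) hn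
  have hδ := dampMin_pos hc₀ hc
  rcases freq_eq_zero_or j with h0 | h0
  · rw [lfSin, if_pos h0, wt_eq_one h0, abs_of_nonneg (by positivity)]
    have := inv_pos.2 hδ
    linarith
  · have hf : 0 < freq j := zero_lt_one.trans_le h0.1
    have hρ := hδ.trans_le (dampMin_le hh hj)
    rw [lfSin, if_neg hf.ne', h0.2, abs_div, abs_of_pos (mul_pos hf hρ), div_eq_mul_inv, mul_inv,
      mul_comm (freq j)⁻¹, ← mul_assoc]
    refine mul_le_mul_of_nonneg_right ?_ (inv_nonneg.2 hf.le)
    refine (mul_le_of_le_one_left (inv_nonneg.2 hρ.le) (Real.abs_sin_le_one _)).trans ?_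
    have := inv_anti₀ hδ (dampMin_le hh hj)
    linarith

/-- The phases agree, so only the amplitudes differ, by `φ - sin φ` over `φ sin φ` times `h`, with
`φ` the phase. The bound has no smoothing factor, which suffices because the nonlinearity is bounded
in `H^(s+1)`. -/
theorem abs_sinK_modFreq_sub_lfSin_le (hh : 0 < h) (hj : h * freq j ≤ c) (hc₀ : 0 ≤ c)
    (hc : c < 2) : |sinK (modFreq h j) (n * h) - lfSin h j n| ≤ 2 * (dampMin c)⁻¹ * h := by
  have hδ := dampMin_pos hc₀ hc
  rcases freq_eq_zero_or j with h0 | h0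
  · rw [sinK, lfSin, if_pos (by rw [modFreq_eq, phase_eq_zero h0, zero_div]), if_pos h0, sub_self,
      abs_zero]
    positivity
  · have hf : 0 < freq j := zero_lt_one.trans_le h0.1
    have hρ := hδ.trans_le (dampMin_le hh hj)
    have hx := mul_pos hh hf
    have hξ : 0 < phase h j := hx.trans_le (le_phase hh hj hc)
    have hm : modFreq h j ≠ 0 := by rw [modFreq_eq]; positivity
    have h1 : |phase h j - Real.sin (phase h j)| ≤ phase h j ^ 3 / 6 := by
      have := Real.abs_sub_sin_le (phase h j)
      rwa [abs_of_pos hξ] at this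
    have h2 := phase_le hh hj hc
    rw [sinK, lfSin, if_neg hm, if_neg hf.ne', mul_modFreq hh, modFreq_eq]
    have e : Real.sin (n * phase h j) / (phase h j / h) -
        Real.sin (n * phase h j) / (freq j * damp h j)
        = -(Real.sin (n * phase h j) * ((phase h j - Real.sin (phase h j)) *
          (phase h j * (freq j * damp h j))⁻¹)) := by
      rw [sin_phase hh]
      field_simp
      ring
    have hp : 0 < phase h j * (freq j * damp h j) := by positivity
    rw [e, abs_neg, abs_mul]
    refine (mul_le_of_le_one_left (abs_nonneg _) (Real.abs_sin_le_one _)).trans ?_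
    rw [abs_mul, abs_of_pos (inv_pos.2 hp), ← div_eq_mul_inv, div_le_iff₀ hp]
    refine h1.trans ?_
    have h3 : phase h j ^ 2 ≤ 8 * (h * freq j) := by nlinarith
    have h4 : 1 ≤ (dampMin c)⁻¹ * damp h j := by
      rw [inv_mul_eq_div, one_le_div hδ]
      exact dampMin_le hh hj
    calc phase h j ^ 3 / 6 = phase h j * (phase h j ^ 2 / 6) := by ring
      _ ≤ phase h j * (2 * (h * freq j) * 1) :=
          mul_le_mul_of_nonneg_left (by linarith) hξ.le
      _ ≤ phase h j * (2 * (h * freq j) * ((dampMin c)⁻¹ * damp h j)) := by gcongr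
      _ = _ := by ring

end Kernel

/-- A discrete Gronwall inequality whose hypothesis is only needed as long as `a ≤ b`. -/
theorem discrete_gronwall {a : ℕ → ℝ} {D q b : ℝ} {N : ℕ} (hq : 0 ≤ q) (hD : 0 ≤ D)
    (hb : D * (1 + q) ^ N ≤ b)
    (h : ∀ n ≤ N, (∀ m < n, a m ≤ b) → a n ≤ D + q * ∑ m ∈ range n, a m) :
    ∀ n ≤ N, a n ≤ D * (1 + q) ^ n := by
  -- The majorant `D (1 + q)^n` solves the summed inequality with equality.
  have hsum : ∀ n : ℕ, D + q * ∑ m ∈ range n, D * (1 + q) ^ m = D * (1 + q) ^ n := by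
    intro n
    induction n with
    | zero => simp
    | succ n ih => rw [sum_range_succ, mul_add, ← add_assoc, ih]; ring
  intro n
  induction n using Nat.strong_induction_on with
  | _ n ih =>
    intro hn
    have h1 : ∀ m < n, a m ≤ D * (1 + q) ^ m := fun m hm => ih m hm (by omega)
    refine (h n hn fun m hm => (h1 m hm).trans (le_trans ?_ hb)).trans ?_
    · exact mul_le_mul_of_nonneg_left (pow_le_pow_right₀ (by linarith) (by omega)) hD
    · rw [← hsum n]
      gcongr with m hm
      exact h1 m (mem_range.1 hm)

theorem one_add_pow_le_exp {L h T : ℝ} (hL : 0 ≤ L) (hh : 0 ≤ h) {n : ℕ} (hn : (n : ℝ) * h ≤ T) :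
    (1 + h * L) ^ n ≤ Real.exp (L * T) := by
  have h1 : 1 + h * L ≤ Real.exp (h * L) := by linarith [Real.add_one_le_exp (h * L)]
  refine (pow_le_pow_left₀ (by positivity) h1 n).trans ?_
  rw [← Real.exp_nat_mul]
  refine Real.exp_le_exp.2 ?_
  nlinarith

/-- Comparison of the nonlinear terms in two discrete variation-of-constants formulas. -/
theorem sobNorm_smul_trap_sub_le {σ h T D : ℝ} (hh : 0 ≤ h) (h1 : h ≤ 1) {n : ℕ}
    (hn : (n : ℝ) * h ≤ T) {k l : Modes K → ℕ → ℝ} {G H : ℕ → Coeff K}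
    (hD : ∀ m ≤ n, sobNorm σ (diag (fun j => k j m - l j (n - m)) (G m)) ≤ D) :
    sobNorm σ (h • (trap n fun m => diag (fun j => k j m) (G m)) -
        h • trap n fun m => diag (fun j => l j (n - m)) (H m))
      ≤ (T + 1) * D + h * ∑ m ∈ range (n + 1),
        sobNorm σ (diag (fun j => l j (n - m)) (G m - H m)) := by
  have hD0 : 0 ≤ D := (sobNorm_nonneg _ _).trans (hD 0 (Nat.zero_le n))
  rw [← smul_sub, trap_sub, sobNorm_smul, abs_of_nonneg hh]
  have h2 : ∑ m ∈ range (n + 1), sobNorm σ (diag (fun j => k j m) (G m) -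
      diag (fun j => l j (n - m)) (H m)) ≤ ∑ m ∈ range (n + 1),
        (D + sobNorm σ (diag (fun j => l j (n - m)) (G m - H m))) := by
    refine sum_le_sum fun m hm => ?_
    -- Kernel error on the exact nonlinearity, plus the numerical kernel on the difference of
    -- nonlinearities.
    have e : diag (fun j => k j m) (G m) - diag (fun j => l j (n - m)) (H m)
        = diag (fun j => k j m - l j (n - m)) (G m) + diag (fun j => l j (n - m)) (G m - H m) := by
      funext j
      simp only [diag, Pi.sub_apply, Pi.add_apply]
      push_cast
      ring
    rw [e]
    exact (sobNorm_add_le _ _ _).trans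
      (add_le_add_left (hD m (by have := mem_range.1 hm; omega)) _)
  refine (mul_le_mul_of_nonneg_left ((sobNorm_trap_le σ n _).trans h2) hh).trans ?_
  rw [sum_add_distrib, sum_const, card_range, nsmul_eq_mul, mul_add]
  push_cast
  -- There are `n + 1` summands, and `h (n + 1) ≤ T + 1` because `h ≤ 1`.
  nlinarith

/-- For `β ≤ 1` the term with `h⁻¹` suffices. For `1 ≤ β` genuine interpolation only needs the
exponent `-2(β - 1)`, which `-(3β/2)` undercuts, and the comparison of `X⁻²` with `h` decides which
term dominates. The loss `3β/2` is thus dictated by dispersion, not by quadrature. -/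
theorem rpow_interpolation {h X β : ℝ} (hh : 0 < h) (h1 : h ≤ 1) (hX : 1 ≤ X) (hβ : 0 ≤ β)
    (hβ₂ : β ≤ 2) : X ^ (-(3 * β / 2)) ≤ h ^ β * (h⁻¹ + h⁻¹ ^ 2 * X ^ (-2 : ℝ)) := by
  have hX0 : 0 < X := zero_lt_one.trans_le hX
  have hb : 0 < h ^ β := Real.rpow_pos_of_pos hh β
  have hX2 : 0 < X ^ (-2 : ℝ) := Real.rpow_pos_of_pos hX0 _
  have e1 : h ^ (β - 1) = h ^ β * h⁻¹ := by
    rw [Real.rpow_sub hh, Real.rpow_one, div_eq_mul_inv]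
  rcases le_total β 1 with h2 | h2
  · have h3 : X ^ (-(3 * β / 2)) ≤ 1 := Real.rpow_le_one_of_one_le_of_nonpos hX (by linarith)
    have h4 : 1 ≤ h ^ (β - 1) := Real.one_le_rpow_of_pos_of_le_one_of_nonpos hh h1 (by linarith)
    have : 0 < h ^ β * (h⁻¹ ^ 2 * X ^ (-2 : ℝ)) := by positivity
    rw [mul_add, ← e1]
    linarith
  · have h3 : X ^ (-(3 * β / 2)) ≤ (X ^ (-2 : ℝ)) ^ (β - 1) := by
      rw [← Real.rpow_mul hX0.le]
      exact Real.rpow_le_rpow_of_exponent_le hX (by linarith)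
    refine h3.trans ?_
    rw [mul_add]
    rcases le_total (X ^ (-2 : ℝ)) h with h4 | h4
    · have h5 : (X ^ (-2 : ℝ)) ^ (β - 1) ≤ h ^ (β - 1) :=
        Real.rpow_le_rpow hX2.le h4 (by linarith)
      have : 0 < h ^ β * (h⁻¹ ^ 2 * X ^ (-2 : ℝ)) := by positivity
      rw [← e1]
      linarith
    · have h5 : (X ^ (-2 : ℝ)) ^ (β - 2) ≤ h ^ (β - 2) :=
        Real.rpow_le_rpow_of_nonpos hh h4 (by linarith)
      have h6 : (X ^ (-2 : ℝ)) ^ (β - 1) = X ^ (-2 : ℝ) * (X ^ (-2 : ℝ)) ^ (β - 2) := by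
        rw [show β - 1 = 1 + (β - 2) by ring, Real.rpow_add hX2, Real.rpow_one]
      have e2 : h ^ (β - 2) = h ^ β * h⁻¹ ^ 2 := by
        rw [Real.rpow_sub hh, Real.rpow_two, div_eq_mul_inv, inv_pow]
      have h7 := mul_le_mul_of_nonneg_left h5 hX2.le
      rw [← h6, e2] at h7
      have : 0 < h ^ β * h⁻¹ := by positivity
      linarith

/-- Interpolation between a first-order bound in `H^r` and a second-order bound in `H^(r-2)`. -/
theorem sobNorm_interpolation {r h β D : ℝ} (hh : 0 < h) (h1 : h ≤ 1) (hβ : 0 ≤ β) (hβ₂ : β ≤ 2)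
    {u : Coeff K} (hu₁ : sobNorm r u ≤ D * h) (hu₂ : sobNorm (r - 2) u ≤ D * h ^ 2) :
    sobNorm (r - 3 * β / 2) u ≤ 2 * D * h ^ β := by
  have hD : 0 ≤ D := nonneg_of_mul_nonneg_left ((sobNorm_nonneg _ _).trans hu₁) hh
  have hb : 0 < h ^ β := Real.rpow_pos_of_pos hh β
  refine sobNorm_le_of_sq (by positivity) ?_
  have h2 : ∀ j : Modes K, (wt j ^ (r - 3 * β / 2) * ‖u j‖) ^ 2 ≤ (h ^ β) ^ 2 * 2 *
      (h⁻¹ ^ 2 * (wt j ^ r * ‖u j‖) ^ 2 + (h⁻¹ ^ 2) ^ 2 * (wt j ^ (r - 2) * ‖u j‖) ^ 2) := by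
    intro j
    have h3 := rpow_interpolation hh h1 (one_le_wt j) hβ hβ₂
    have h4 : wt j ^ (r - 3 * β / 2) * ‖u j‖
        ≤ h ^ β * (h⁻¹ * (wt j ^ r * ‖u j‖) + h⁻¹ ^ 2 * (wt j ^ (r - 2) * ‖u j‖)) := by
      rw [sub_eq_add_neg, Real.rpow_add (wt_pos j), sub_eq_add_neg r 2, Real.rpow_add (wt_pos j)]
      have := mul_le_mul_of_nonneg_left h3 (mul_nonneg (wt_rpow_nonneg r j) (norm_nonneg (u j)))
      linarith
    refine (pow_le_pow_left₀ (mul_nonneg (wt_rpow_nonneg _ j) (norm_nonneg _)) h4 2).trans ?_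
    rw [mul_pow, mul_assoc]
    refine mul_le_mul_of_nonneg_left (add_sq_le.trans (le_of_eq ?_)) (sq_nonneg _)
    ring
  refine (sum_le_sum fun j _ => h2 j).trans ?_
  rw [← mul_sum, sum_add_distrib, ← mul_sum, ← mul_sum, ← sobNorm_sq, ← sobNorm_sq]
  have h5 := pow_le_pow_left₀ (sobNorm_nonneg _ _) hu₁ 2
  have h6 := pow_le_pow_left₀ (sobNorm_nonneg _ _) hu₂ 2
  calc _ ≤ (h ^ β) ^ 2 * 2 * (h⁻¹ ^ 2 * (D * h) ^ 2 + (h⁻¹ ^ 2) ^ 2 * (D * h ^ 2) ^ 2) := by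
        gcongr
    _ = _ := by
        field_simp
        ring

end SemiWave

end

/-! ### Boundedness of leapfrog through the modified system. -/

noncomputable section

namespace SemiWave

open Finset hiding Icc
open Set

variable {K : ℕ}

theorem diag_sub_symbol (k l : Modes K → ℝ) (y : Coeff K) :
    diag k y - diag l y = diag (fun j => k j - l j) y := by
  funext j
  simp only [diag, Pi.sub_apply]
  push_cast
  ring

/-- The inverse weight of the sine propagator compensates the derivative lost by the Lipschitz
estimate. The summand `m = n` drops out since the propagator vanishes there, which leaves an
explicit Gronwall sum over earlier steps. -/
theorem sum_lfSin_nonlin_le {p n : ℕ} {h τ r R L A : ℝ} (hA : 0 ≤ A)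
    (hLip : ∀ y z : Coeff K, sobNorm r y ≤ R → sobNorm r z ≤ R →
      sobNorm (τ - 1) (nonlin p y - nonlin p z) ≤ L * sobNorm τ (y - z))
    (hS : ∀ m ≤ n, ∀ j : Modes K, |lfSin h j m| ≤ A * (wt j)⁻¹) {x y : ℕ → Coeff K}
    (hx : ∀ m < n, sobNorm r (x m) ≤ R) (hy : ∀ m < n, sobNorm r (y m) ≤ R) :
    ∑ m ∈ range (n + 1), sobNorm τ (diag (fun j => lfSin h j (n - m))
        (nonlin p (x m) - nonlin p (y m)))
      ≤ A * L * ∑ m ∈ range n, sobNorm τ (x m - y m) := by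
  rw [sum_range_succ, mul_sum]
  simp only [Nat.sub_self, lfSin_zero, diag_zero, sobNorm_zero, add_zero]
  refine sum_le_sum fun m hm => ?_
  have hm' := mem_range.1 hm
  have h1 := sobNorm_diag_le (σ := τ) (b := -1) hA (m := fun j => lfSin h j (n - m))
    (fun j => by rw [Real.rpow_neg_one]; exact hS (n - m) (Nat.sub_le n m) j)
    (nonlin p (x m) - nonlin p (y m))
  refine h1.trans ?_
  rw [mul_assoc, ← sub_eq_add_neg]
  exact mul_le_mul_of_nonneg_left (hLip _ _ (hx m hm') (hy m hm')) hA

/-- The leapfrog positions stay bounded in `H^(s+1)` as long as the solution with modified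
frequencies has finite energy. -/
theorem exists_leapfrog_bound (p : ℕ) {s : ℝ} (hs : 0 ≤ s) (M : ℝ) {T : ℝ} (hT : 0 ≤ T) {c : ℝ}
    (hc₀ : 0 ≤ c) (hc : c < 2) :
    ∃ h₀ : ℝ, 0 < h₀ ∧ h₀ ≤ 1 ∧ ∀ K : ℕ, 1 ≤ K → ∀ h : ℝ, 0 < h → h ≤ h₀ →
      (∀ j : Modes K, h * freq j ≤ c) → ∀ (t₀ : ℝ) (z w : ℝ → Coeff K) (v₀ : Coeff K),
        IsSolution p (modFreq h) t₀ T z w → FiniteEnergy s M t₀ T z w →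
        (∀ j, w t₀ j = ((Real.sinc (h * modFreq h j) : ℝ) : ℂ)⁻¹ * v₀ j) →
        ∀ n : ℕ, (n : ℝ) * h ≤ T → sobNorm (s + 1) (leapfrog p h (z t₀) v₀ n) ≤ M + 1 := by
  obtain ⟨B, hB, hf⟩ := exists_sobNorm_deriv_nonlin_le hs M p
  obtain ⟨L, hL, hLip⟩ := exists_nonlin_lipschitz (r := s + 1) (by linarith) (M + 1) p
  have hδ := inv_pos.2 (dampMin_pos hc₀ hc)
  set A := 2 + T + (dampMin c)⁻¹ with hAdef
  have hA : 0 ≤ A := by positivity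
  -- Quadrature defect plus accumulated kernel mismatch, each per unit of `h`.
  set D := 2 * (4 + T) * B * T + (T + 1) * (2 * (dampMin c)⁻¹ * B) with hDdef
  have hD : 0 ≤ D := by positivity
  have hE := Real.exp_pos (A * L * T)
  -- The threshold makes the Gronwall majorant at most 1, so the iterates never leave the ball of
  -- radius `M + 1` on which `L` is a Lipschitz constant.
  refine ⟨min 1 (1 / (D * Real.exp (A * L * T) + 1)), lt_min one_pos (by positivity),
    min_le_left _ _, fun K hK h hh hh₀ hj t₀ z w v₀ hz hen hw N hN => ?_⟩
  have hh1 : h ≤ 1 := hh₀.trans (min_le_left _ _)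
  have hsmall : D * h * Real.exp (A * L * T) ≤ 1 := by
    have h1 := hh₀.trans (min_le_right _ _)
    rw [le_div_iff₀ (by positivity)] at h1
    nlinarith
  have hW := freqLike_modFreq hh hc hj
  have hfz := fun t ht => hf K hK (modFreq h) (z t) (w t) (fun j => hW.abs_le j) (hen t ht)
  have hzM : ∀ t ∈ Icc t₀ (t₀ + T), sobNorm (s + 1) (z t) ≤ M := fun t ht => by
    linarith [hen t ht, sobNorm_nonneg s (w t)]
  have hpow : D * h * (1 + h * (A * L)) ^ N ≤ 1 := by
    refine le_trans ?_ hsmall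
    exact mul_le_mul_of_nonneg_left (one_add_pow_le_exp (by positivity) hh.le hN) (by positivity)
  have hmem : ∀ n ≤ N, (n : ℝ) * h ≤ T := fun n hn =>
    (mul_le_mul_of_nonneg_right (Nat.cast_le.2 hn) hh.le).trans hN
  have hlf : ∀ n ≤ N, sobNorm (s + 1) (z (t₀ + n * h) - leapfrog p h (z t₀) v₀ n) ≤ 1 →
      sobNorm (s + 1) (leapfrog p h (z t₀) v₀ n) ≤ M + 1 := fun n hn h1 => by
    have h2 := sobNorm_sub_le (s + 1) (z (t₀ + n * h))
      (z (t₀ + n * h) - leapfrog p h (z t₀) v₀ n)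
    rw [sub_sub_cancel] at h2
    linarith [hzM _ (node_mem_Icc (t₀ := t₀) hh.le (hmem n hn))]
  have key := discrete_gronwall
    (a := fun n => sobNorm (s + 1) (z (t₀ + n * h) - leapfrog p h (z t₀) v₀ n))
    (D := D * h) (q := h * (A * L)) (b := 1) (N := N) (by positivity) (by positivity) hpow ?_
  · refine hlf N le_rfl ((key N le_rfl).trans hpow)
  · intro n hn hprev
    have hnT := hmem n hn
    have e₁ : diag (fun j => Real.cos (modFreq h j * (n * h))) (z t₀)
        = diag (fun j => lfCos h j n) (z t₀) := by
      simp only [mul_modFreq hh, lfCos]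
    -- Here the modified initial velocity matters: the factor `sinc⁻¹` converts the amplitude `1 /
    -- ω̃` into that of `lfSin`, so the linear parts cancel exactly.
    have e₂ : diag (fun j => sinK (modFreq h j) (n * h)) (w t₀)
        = diag (fun j => lfSin h j n) v₀ := by
      funext j
      simp only [diag, hw, ← mul_assoc]
      congr 1
      rw [← Complex.ofReal_inv, ← Complex.ofReal_mul]
      congr 1
      have hm : h * modFreq h j = phase h j := by rw [modFreq_eq]; field_simp
      rcases freq_eq_zero_or j with h0 | h0
      · rw [hm, phase_eq_zero h0, Real.sinc_zero, sinK, lfSin,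
          if_pos (by rw [modFreq_eq, phase_eq_zero h0, zero_div]), if_pos h0]
        simp
      · have hf0 : 0 < freq j := zero_lt_one.trans_le h0.1
        have hξ : 0 < phase h j := (mul_pos hh hf0).trans_le (le_phase hh (hj j) hc)
        have hρ := (dampMin_pos hc₀ hc).trans_le (dampMin_le hh (hj j))
        rw [hm, Real.sinc_of_ne_zero hξ.ne', sinK, lfSin,
          if_neg (by rw [modFreq_eq]; positivity), if_neg hf0.ne', mul_modFreq hh, modFreq_eq,
          sin_phase hh]
        field_simp
    have e : z (t₀ + n * h) - leapfrog p h (z t₀) v₀ n = posDefect p (modFreq h) t₀ h z w n +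
        (h • (trap n fun m => diag (fun j => sinK (modFreq h j) (n * h - m * h))
            (nonlin p (z (t₀ + m * h)))) -
          h • trap n fun m => diag (fun j => lfSin h j (n - m))
            (nonlin p (leapfrog p h (z t₀) v₀ m))) := by
      rw [posDefect, e₁, e₂, leapfrog_eq p hh hc₀ hc hj (z t₀) v₀ n]
      abel
    have hd := (sobNorm_defect_le hK hW hh.le hT hz (fun t ht => (hfz t ht).1)
      (fun t ht => (hfz t ht).2.1) n hnT).1
    have ht := sobNorm_smul_trap_sub_le (σ := s + 1) (D := 2 * (dampMin c)⁻¹ * h * B) hh.le hh1 hnT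
      (k := fun j m => sinK (modFreq h j) (n * h - m * h)) (l := lfSin h)
      (G := fun m => nonlin p (z (t₀ + m * h)))
      (H := fun m => nonlin p (leapfrog p h (z t₀) v₀ m)) (fun m hm => ?_)
    · have hs := sum_lfSin_nonlin_le (p := p) (n := n) (h := h) (τ := s + 1) (L := L) hA
        (fun y z hy hz => hLip K hK y z hy hz (s + 1) (abs_of_nonneg (by linarith)).le)
        (fun m hm j => abs_lfSin_le hh (hj j) hc₀ hc (hmem m (hm.trans hn)))
        (x := fun m => z (t₀ + m * h)) (y := leapfrog p h (z t₀) v₀)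
        (fun m hm => (hzM _ (node_mem_Icc hh.le (hmem m (hm.le.trans hn)))).trans (by linarith))
        (fun m hm => hlf m (hm.le.trans hn) (hprev m hm))
      have h5 := mul_le_mul_of_nonneg_left hs hh.le
      change sobNorm (s + 1) (z (t₀ + n * h) - leapfrog p h (z t₀) v₀ n) ≤ _
      rw [e]
      refine (sobNorm_add_le _ _ _).trans ?_
      calc _ ≤ 2 * (4 + T) * B * T * h + ((T + 1) * (2 * (dampMin c)⁻¹ * h * B) + h * (A * L *
            ∑ m ∈ range n, sobNorm (s + 1) (z (t₀ + m * h) - leapfrog p h (z t₀) v₀ m))) :=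
            add_le_add hd (ht.trans (by linarith))
        _ = D * h + h * (A * L) *
            ∑ m ∈ range n, sobNorm (s + 1) (z (t₀ + m * h) - leapfrog p h (z t₀) v₀ m) := by
            rw [hDdef]; ring
    · have hmn : (n : ℝ) * h - m * h = ((n - m : ℕ) : ℝ) * h := by
        rw [Nat.cast_sub hm]; ring
      have h6 := sobNorm_diag_le (σ := s + 1) (b := 0) (C := 2 * (dampMin c)⁻¹ * h)
        (m := fun j => sinK (modFreq h j) (n * h - m * h) - lfSin h j (n - m)) (by positivity)
        (fun j => by
          rw [Real.rpow_zero, mul_one, hmn]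
          exact abs_sinK_modFreq_sub_lfSin_le hh (hj j) hc₀ hc) (nonlin p (z (t₀ + m * h)))
      rw [add_zero] at h6
      exact h6.trans (mul_le_mul_of_nonneg_left
        (hfz _ (node_mem_Icc hh.le (hmem m (hm.trans hn)))).1 (by positivity))

end SemiWave

end

/-! ### The error of leapfrog against the original solution. -/

noncomputable section

namespace SemiWave

open Finset hiding Icc
open Set

variable {K : ℕ}

/-- Error of the leapfrog method for data `y`, `v` whose leapfrog positions are bounded. -/
theorem exists_leapfrog_error_le (p : ℕ) {s : ℝ} (hs : 0 ≤ s) (M : ℝ) {T : ℝ} (hT : 0 ≤ T) {c : ℝ}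
    (hc₀ : 0 ≤ c) (hc : c < 2) :
    ∃ C : ℝ, 0 < C ∧ ∀ β : ℝ, 0 ≤ β → β ≤ 2 → 3 * β / 2 ≤ s + 2 →
      ∀ K : ℕ, 1 ≤ K → ∀ h : ℝ, 0 < h → h ≤ 1 → (∀ j : Modes K, h * freq j ≤ c) →
      ∀ (t₀ : ℝ) (y v : ℝ → Coeff K), IsSolution p freq t₀ T y v → FiniteEnergy s M t₀ T y v →
      ∀ N : ℕ, (N : ℝ) * h ≤ T →
        (∀ n ≤ N, sobNorm (s + 1) (leapfrog p h (y t₀) (v t₀) n) ≤ M + 1) →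
        sobNorm (s + 1 - 3 * β / 2) (y (t₀ + N * h) - leapfrog p h (y t₀) (v t₀) N) +
          sobNorm (s - 3 * β / 2) (v (t₀ + N * h) - leapfrogVel p h (y t₀) (v t₀) N)
        ≤ C * h ^ β := by
  obtain ⟨B, hB, hf⟩ := exists_sobNorm_deriv_nonlin_le hs M p
  obtain ⟨L, hL, hLip⟩ := exists_nonlin_lipschitz (r := s + 1) (by linarith) (M + 1) p
  have hδ := inv_pos.2 (dampMin_pos hc₀ hc)
  set A := 3 + T + (dampMin c)⁻¹ with hAdef
  have hA : 0 ≤ A := by positivity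
  set Q := 2 * (4 * (4 + T) * B * T) with hQdef
  have hQ : 0 ≤ Q := by positivity
  -- Interpolated quadrature defect, propagator errors on the two initial data, and kernel error on
  -- the nonlinearity.
  set D := Q + 2 * (A * |M|) + (T + 1) * (A * B) with hDdef
  have hD : 0 ≤ D := by positivity
  set E := Real.exp (A * L * T) with hEdef
  have hE : 0 < E := Real.exp_pos _
  -- The first summand bounds the positions, the second the velocities.
  refine ⟨D * E + (D + (T + 1) * (L * (D * E))) + 1, by positivity,
    fun β hβ hβ₂ hβs K hK h hh hh1 hj t₀ y v hy hen N hN hlf => ?_⟩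
  have hW : FreqLike (freq : Modes K → ℝ) := freqLike_freq
  have hfy := fun t ht => hf K hK freq (y t) (v t) (fun j => hW.abs_le j) (hen t ht)
  have hyM : ∀ t ∈ Icc t₀ (t₀ + T), sobNorm (s + 1) (y t) ≤ M := fun t ht => by
    linarith [hen t ht, sobNorm_nonneg s (v t)]
  have ht₀ : t₀ ∈ Icc t₀ (t₀ + T) := ⟨le_rfl, by linarith⟩
  have hy₀ : sobNorm (s + 1) (y t₀) ≤ |M| := (hyM t₀ ht₀).trans (le_abs_self M)
  have hv₀ : sobNorm s (v t₀) ≤ |M| := by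
    linarith [hen t₀ ht₀, sobNorm_nonneg (s + 1) (y t₀), le_abs_self M]
  have hmem : ∀ n ≤ N, (n : ℝ) * h ≤ T := fun n hn =>
    (mul_le_mul_of_nonneg_right (Nat.cast_le.2 hn) hh.le).trans hN
  have hhβ : 0 < h ^ β := Real.rpow_pos_of_pos hh β
  have hμ : ∀ j : Modes K, 0 ≤ min 1 (h ^ 2 * wt j ^ 3) ∧
      min 1 (h ^ 2 * wt j ^ 3) ≤ h ^ β * wt j ^ (3 * β / 2) := fun j =>
    ⟨le_min zero_le_one (mul_nonneg (sq_nonneg h) (pow_nonneg (wt_pos j).le 3)),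
      min_one_le_rpow hh (wt_pos j) hβ hβ₂⟩
  set τ := s + 1 - 3 * β / 2 with hτ
  have hτ' : s - 3 * β / 2 = τ - 1 := by rw [hτ]; ring
  -- The condition `3 * β / 2 ≤ s + 2` gives `τ ≥ -1 ≥ -(s + 1)`; negative `τ` does occur, hence the
  -- product estimate in negative norms.
  have hτabs : |τ| ≤ s + 1 := _root_.abs_le.2 ⟨by linarith, by linarith⟩
  have hscale : ∀ {a : ℝ} {j : Modes K}, 0 ≤ a → a ≤ A →
      a * min 1 (h ^ 2 * wt j ^ 3) ≤ A * h ^ β * wt j ^ (3 * β / 2) := fun {a j} ha haA => by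
    rw [mul_assoc]
    exact mul_le_mul haA (hμ j).2 (hμ j).1 hA
  have hkcos : ∀ n ≤ N, ∀ j : Modes K,
      |Real.cos (freq j * (n * h)) - lfCos h j n| ≤ A * h ^ β * wt j ^ (3 * β / 2) :=
    fun n hn j => (abs_cos_sub_lfCos_le hh (hj j) hc (hmem n hn)).trans
      (hscale (by positivity) (by rw [hAdef]; linarith))
  have hksin : ∀ n ≤ N, ∀ j : Modes K,
      |sinK (freq j) (n * h) - lfSin h j n| ≤ A * h ^ β * wt j ^ (3 * β / 2 - 1) :=
    fun n hn j => by
      refine (abs_sinK_sub_lfSin_le hh (hj j) hc₀ hc (hmem n hn)).trans ?_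
      rw [Real.rpow_sub_one (wt_pos j).ne', div_eq_mul_inv, ← mul_assoc]
      exact mul_le_mul_of_nonneg_right (hscale (by positivity) (by rw [hAdef]; linarith))
        (inv_nonneg.2 (wt_pos j).le)
  have hkvel : ∀ n ≤ N, ∀ j : Modes K,
      |-(freq j * Real.sin (freq j * (n * h))) - lfVel h j n|
        ≤ A * h ^ β * wt j ^ (3 * β / 2 + 1) :=
    fun n hn j => by
      refine (abs_mul_sin_sub_lfVel_le hh (hj j) hc (hmem n hn)).trans ?_
      rw [Real.rpow_add_one (wt_pos j).ne', ← mul_assoc]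
      exact mul_le_mul_of_nonneg_right (hscale (by positivity) (by rw [hAdef]; linarith))
        (wt_pos j).le
  have hAh : 0 ≤ A * h ^ β := by positivity
  have hnode : ∀ m ≤ N, t₀ + m * h ∈ Icc t₀ (t₀ + T) := fun m hm =>
    node_mem_Icc hh.le (hmem m hm)
  have hsub : ∀ {m n : ℕ}, m ≤ n → (n : ℝ) * h - m * h = ((n - m : ℕ) : ℝ) * h :=
    fun hm => by rw [Nat.cast_sub hm]; ring
  have hfs : ∀ m ≤ N, sobNorm s (nonlin p (y (t₀ + m * h))) ≤ B := fun m hm =>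
    (sobNorm_mono (by linarith) _).trans (hfy _ (hnode m hm)).1
  have hdef₁ := fun n hn => sobNorm_defect_le (s := s) hK hW hh.le hT hy
    (fun t ht => (hfy t ht).1) (fun t ht => (hfy t ht).2.1) n hn
  have hdef₂ := fun n hn => sobNorm_defect_le_sq (s := s) hK hW hh.le hT hy
    (fun t ht => (hfy t ht).1) (fun t ht => (hfy t ht).2.1) (fun t ht => (hfy t ht).2.2) n hn
  have hle : 2 * (4 + T) * B * T * h ≤ 4 * (4 + T) * B * T * h := by
    have : 0 ≤ (4 + T) * B * T * h := by positivity
    linarith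
  set a : ℕ → ℝ := fun n => sobNorm τ (y (t₀ + n * h) - leapfrog p h (y t₀) (v t₀) n) with ha
  have hpos : ∀ n ≤ N, a n ≤ D * h ^ β + h * (A * L) * ∑ m ∈ range n, a m := by
    intro n hn
    have e : y (t₀ + n * h) - leapfrog p h (y t₀) (v t₀) n
        = posDefect p freq t₀ h y v n +
          (diag (fun j => Real.cos (freq j * (n * h)) - lfCos h j n) (y t₀) +
          (diag (fun j => sinK (freq j) (n * h) - lfSin h j n) (v t₀) +
          (h • (trap n fun m => diag (fun j => sinK (freq j) (n * h - m * h))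
              (nonlin p (y (t₀ + m * h)))) -
            h • trap n fun m => diag (fun j => lfSin h j (n - m))
              (nonlin p (leapfrog p h (y t₀) (v t₀) m))))) := by
      rw [posDefect, leapfrog_eq p hh hc₀ hc hj (y t₀) (v t₀) n, ← diag_sub_symbol,
        ← diag_sub_symbol]
      abel
    have b₁ : sobNorm τ (posDefect p freq t₀ h y v n) ≤ Q * h ^ β :=
      sobNorm_interpolation (r := s + 1) hh hh1 hβ hβ₂ ((hdef₁ n (hmem n hn)).1.trans hle)
        (by rw [show s + 1 - 2 = s - 1 by ring]; exact (hdef₂ n (hmem n hn)).1)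
    have b₂ := sobNorm_diag_le (σ := τ) hAh (hkcos n hn) (y t₀)
    have b₃ := sobNorm_diag_le (σ := τ) hAh (hksin n hn) (v t₀)
    rw [show τ + 3 * β / 2 = s + 1 by rw [hτ]; ring] at b₂
    rw [show τ + (3 * β / 2 - 1) = s by rw [hτ]; ring] at b₃
    have b₂' := b₂.trans (mul_le_mul_of_nonneg_left hy₀ hAh)
    have b₃' := b₃.trans (mul_le_mul_of_nonneg_left hv₀ hAh)
    have b₄ := sobNorm_smul_trap_sub_le (σ := τ) (D := A * h ^ β * B) hh.le hh1 (hmem n hn)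
      (k := fun j m => sinK (freq j) (n * h - m * h)) (l := lfSin h)
      (G := fun m => nonlin p (y (t₀ + m * h)))
      (H := fun m => nonlin p (leapfrog p h (y t₀) (v t₀) m)) (fun m hm => by
        have h6 := sobNorm_diag_le (σ := τ) (b := 3 * β / 2 - 1) (C := A * h ^ β)
          (m := fun j => sinK (freq j) (n * h - m * h) - lfSin h j (n - m)) hAh
          (fun j => by rw [hsub hm]; exact hksin (n - m) (by omega) j)
          (nonlin p (y (t₀ + m * h)))
        rw [show τ + (3 * β / 2 - 1) = s by rw [hτ]; ring] at h6
        exact h6.trans (mul_le_mul_of_nonneg_left (hfs m (hm.trans hn)) hAh))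
    have b₅ := sum_lfSin_nonlin_le (p := p) (n := n) (h := h) (τ := τ) (L := L) hA
      (fun y z hy hz => hLip K hK y z hy hz τ hτabs)
      (fun m hm j => (abs_lfSin_le hh (hj j) hc₀ hc (hmem m (hm.trans hn))).trans
        (mul_le_mul_of_nonneg_right (by rw [hAdef]; linarith) (inv_nonneg.2 (wt_pos j).le)))
      (x := fun m => y (t₀ + m * h)) (y := leapfrog p h (y t₀) (v t₀))
      (fun m hm => (hyM _ (hnode m (hm.le.trans hn))).trans (by linarith))
      (fun m hm => hlf m (hm.le.trans hn))
    have b₆ := mul_le_mul_of_nonneg_left b₅ hh.le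
    simp only [ha]
    rw [e]
    refine (sobNorm_add_le _ _ _).trans ((add_le_add b₁ ((sobNorm_add_le _ _ _).trans
      (add_le_add b₂' ((sobNorm_add_le _ _ _).trans (add_le_add b₃'
        (b₄.trans (add_le_add_right b₆ _))))))).trans (le_of_eq ?_))
    rw [hDdef]
    ring
  have hgron : ∀ n ≤ N, a n ≤ D * E * h ^ β := by
    intro n hn
    -- The leapfrog positions are bounded by assumption, so no bootstrap is needed and the threshold
    -- is the majorant itself.
    have h1 := discrete_gronwall (a := a) (D := D * h ^ β) (q := h * (A * L)) (N := N)
      (by positivity) (by positivity) le_rfl (fun n hn _ => hpos n hn) n hn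
    have h2 : (1 + h * (A * L)) ^ n ≤ E :=
      one_add_pow_le_exp (by positivity) hh.le (hmem n hn)
    calc a n ≤ D * h ^ β * (1 + h * (A * L)) ^ n := h1
      _ ≤ D * h ^ β * E := mul_le_mul_of_nonneg_left h2 (by positivity)
      _ = _ := by ring
  -- The cosine kernel does not smooth, but the target norm is one order weaker, so the Lipschitz
  -- loss is harmless and the position bounds finish without another Gronwall argument.
  have hvel : sobNorm (τ - 1) (v (t₀ + N * h) - leapfrogVel p h (y t₀) (v t₀) N)
      ≤ (D + (T + 1) * (L * (D * E))) * h ^ β := by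
    have e : v (t₀ + N * h) - leapfrogVel p h (y t₀) (v t₀) N
        = velDefect p freq t₀ h y v N +
          (diag (fun j => -(freq j * Real.sin (freq j * (N * h))) - lfVel h j N) (y t₀) +
          (diag (fun j => Real.cos (freq j * (N * h)) - lfCos h j N) (v t₀) +
          (h • (trap N fun m => diag (fun j => Real.cos (freq j * (N * h - m * h)))
              (nonlin p (y (t₀ + m * h)))) -
            h • trap N fun m => diag (fun j => lfCos h j (N - m))
              (nonlin p (leapfrog p h (y t₀) (v t₀) m))))) := by
      rw [velDefect, leapfrogVel_eq p hh hc₀ hc hj (y t₀) (v t₀) N, ← diag_sub_symbol,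
        ← diag_sub_symbol]
      abel
    have b₁ : sobNorm (τ - 1) (velDefect p freq t₀ h y v N) ≤ Q * h ^ β := by
      rw [← hτ']
      exact sobNorm_interpolation (r := s) hh hh1 hβ hβ₂ ((hdef₁ N hN).2.trans hle)
        (hdef₂ N hN).2
    have b₂ := sobNorm_diag_le (σ := τ - 1) hAh (hkvel N le_rfl) (y t₀)
    have b₃ := sobNorm_diag_le (σ := τ - 1) hAh (hkcos N le_rfl) (v t₀)
    rw [show τ - 1 + (3 * β / 2 + 1) = s + 1 by rw [hτ]; ring] at b₂
    rw [show τ - 1 + 3 * β / 2 = s by rw [hτ]; ring] at b₃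
    have b₂' := b₂.trans (mul_le_mul_of_nonneg_left hy₀ hAh)
    have b₃' := b₃.trans (mul_le_mul_of_nonneg_left hv₀ hAh)
    have b₄ := sobNorm_smul_trap_sub_le (σ := τ - 1) (D := A * h ^ β * B) hh.le hh1 hN
      (k := fun j m => Real.cos (freq j * (N * h - m * h))) (l := lfCos h)
      (G := fun m => nonlin p (y (t₀ + m * h)))
      (H := fun m => nonlin p (leapfrog p h (y t₀) (v t₀) m)) (fun m hm => by
        have h6 := sobNorm_diag_le (σ := τ - 1) (b := 3 * β / 2) (C := A * h ^ β)
          (m := fun j => Real.cos (freq j * (N * h - m * h)) - lfCos h j (N - m)) hAh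
          (fun j => by rw [hsub hm]; exact hkcos (N - m) (by omega) j)
          (nonlin p (y (t₀ + m * h)))
        rw [show τ - 1 + 3 * β / 2 = s by rw [hτ]; ring] at h6
        exact h6.trans (mul_le_mul_of_nonneg_left (hfs m hm) hAh))
    have b₅ : ∑ m ∈ range (N + 1), sobNorm (τ - 1) (diag (fun j => lfCos h j (N - m))
        (nonlin p (y (t₀ + m * h)) - nonlin p (leapfrog p h (y t₀) (v t₀) m)))
        ≤ ∑ m ∈ range (N + 1), L * (D * E * h ^ β) := by
      refine sum_le_sum fun m hm => ?_
      have hm' : m ≤ N := by have := mem_range.1 hm; omega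
      have h7 := sobNorm_diag_le (σ := τ - 1) (b := 0) zero_le_one
        (m := fun j => lfCos h j (N - m)) (fun j => by
          rw [Real.rpow_zero, mul_one]; exact abs_lfCos_le)
        (nonlin p (y (t₀ + m * h)) - nonlin p (leapfrog p h (y t₀) (v t₀) m))
      rw [add_zero, one_mul] at h7
      exact h7.trans ((hLip K hK _ _ ((hyM _ (hnode m hm')).trans (by linarith)) (hlf m hm') τ
        hτabs).trans (mul_le_mul_of_nonneg_left (hgron m hm') hL))
    have b₆ : h * ∑ m ∈ range (N + 1), sobNorm (τ - 1) (diag (fun j => lfCos h j (N - m))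
        (nonlin p (y (t₀ + m * h)) - nonlin p (leapfrog p h (y t₀) (v t₀) m)))
        ≤ (T + 1) * (L * (D * E * h ^ β)) := by
      refine (mul_le_mul_of_nonneg_left b₅ hh.le).trans ?_
      rw [sum_const, card_range, nsmul_eq_mul, ← mul_assoc]
      refine mul_le_mul_of_nonneg_right ?_ (by positivity)
      push_cast
      linarith
    rw [e]
    refine (sobNorm_add_le _ _ _).trans ((add_le_add b₁ ((sobNorm_add_le _ _ _).trans
      (add_le_add b₂' ((sobNorm_add_le _ _ _).trans (add_le_add b₃'
        (b₄.trans (add_le_add_right b₆ _))))))).trans (le_of_eq ?_))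
    rw [hDdef]
    ring
  rw [hτ']
  have h8 := add_le_add (hgron N le_rfl) hvel
  refine h8.trans ?_
  nlinarith

end SemiWave

end

/-! ### Conclusion. -/

theorem theorem2 (p : ℕ) (hp : 2 ≤ p) (s : ℝ) (hs : 0 ≤ s) (M T : ℝ) (hT : 0 ≤ T)
    (c₀ : ℝ) (hc₀ : c₀ < 2) :
    ∃ C h₀ : ℝ, 0 < C ∧ 0 < h₀ ∧
      ∀ α : ℝ, -1 ≤ α → α ≤ min 1 (2 / 3 * s + 1 / 3) →
      ∀ K : ℕ, 1 ≤ K → ∀ h : ℝ, 0 < h → h ≤ h₀ → h * (K : ℝ) ≤ c₀ →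
      ∀ (t₀ : ℝ) (y v z w : ℝ → SemiWave.Coeff K),
        SemiWave.IsSolution p SemiWave.freq t₀ T y v →
        SemiWave.FiniteEnergy s M t₀ T y v →
        SemiWave.IsSolution p (SemiWave.modFreq h) t₀ T z w →
        z t₀ = y t₀ →
        (∀ j, w t₀ j = ((Real.sinc (h * SemiWave.modFreq h j) : ℝ) : ℂ)⁻¹ * v t₀ j) →
        SemiWave.FiniteEnergy s M t₀ T z w →
        ∀ n : ℕ, (n : ℝ) * h ≤ T →
          SemiWave.sobNorm (s + 1 - 3 * (1 + α) / 2)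
              (y (t₀ + n * h) - SemiWave.leapfrog p h (y t₀) (v t₀) n) +
            SemiWave.sobNorm (s - 3 * (1 + α) / 2)
              (v (t₀ + n * h) - SemiWave.leapfrogVel p h (y t₀) (v t₀) n)
          ≤ C * h ^ (1 + α) := by
  -- The lemmas require a nonnegative step-size constant, whereas `c₀` may be negative.
  have hc : max c₀ 0 < 2 := max_lt hc₀ two_pos
  obtain ⟨h₀, hh₀, hh₁, hbound⟩ :=
    SemiWave.exists_leapfrog_bound p hs M hT (le_max_right c₀ 0) hc
  obtain ⟨C, hC, herror⟩ :=
    SemiWave.exists_leapfrog_error_le p hs M hT (le_max_right c₀ 0) hc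
  refine ⟨C, h₀, hC, hh₀, fun α hα hα' K hK h hh hle hhK t₀ y v z w hy hyM hz hzy hw hzM n hn => ?_⟩
  have hα₁ := hα'.trans (min_le_left _ _)
  have hα₂ := hα'.trans (min_le_right _ _)
  have hj : ∀ j : SemiWave.Modes K, h * SemiWave.freq j ≤ max c₀ 0 := fun j =>
    (mul_le_mul_of_nonneg_left (SemiWave.freq_le_card j) hh.le).trans
      (hhK.trans (le_max_left _ _))
  -- With `β = 1 + α`, the bound `α ≤ 2s/3 + 1/3` is exactly `3 * β / 2 ≤ s + 2`.
  refine herror (1 + α) (by linarith) (by linarith) (by linarith) K hK h hh (hle.trans hh₁) hj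
    t₀ y v hy hyM n hn fun m hm => ?_
  rw [← hzy]
  exact hbound K hK h hh hle hj t₀ z w (v t₀) hz hzM hw m
    ((mul_le_mul_of_nonneg_right (Nat.cast_le.2 hm) hh.le).trans hn)
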